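/- Let $T$ be a finite rooted tree all of whose leaves lie at the same depth $d\ge 1$; let $L$ be the set of leaves and $I$ the set of inner nodes, and for $v\in I$ let $C_v$ be the set of children of $v$. Let $v_1,\dots,v_k$ be the nodes of depth $d-1$, and let a partial order on $C_{v_i}$ be given for each $i$; the resulting poset $P_{v_i}$ is called a leaf poset. Assume every leaf poset is a rooted forest, i.e. each of its elements is covered by at most one element. Let $P$ be the disjoint union of the leaf posets. A *linear extension* of an $n$-element poset is an ordering $\pi=\pi_1\cdots\pi_n$ of its elements such that $\pi_i\prec\pi_j$ implies $i<j$. Let $\mathcal L(T)$ be the set of families $\pi=(\pi_v)_{v\in I}$, where $\pi_v$ is a linear extension of $P_v$ if $v$ has depth $d-1$, and an arbitrary total ordering of $C_v$ otherwise. Let $\mathcal A(L)$ be the set of all $E\subseteq L$ containing no two distinct siblings, and for $E\in\mathcal A(L)$ let $C_v^E$ be the set of those $c\in C_v$ that have a descendant in $E$ ($c$ itself counts as a descendant of $c$). For a linear extension $\pi$ of an $n$-element poset, $\tau_i\pi$ is obtained by interchanging $\pi_i$ and $\pi_{i+1}$ if they are incomparable, and $\tau_i\pi=\pi$ otherwise;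 for an element $a=\pi_j$ put $\widehat\partial_a\pi=\tau_{n-1}\cdots\tau_{j+1}\tau_j\pi$ ($\tau_j$ is applied first). For $E\in\mathcal A(L)$ define $\widehat\partial_E:\mathcal L(T)\to\mathcal L(T)$ componentwise: if $v$ has depth $d-1$, then $\pi_v$ is replaced by $\widehat\partial_a\pi_v$ when $C_v^E=\{a\}$ and is unchanged when $C_v^E=\emptyset$; at every other inner node $v$ the elements of $C_v^E$ are moved to the end of $\pi_v$, the relative order inside $C_v^E$ and inside $C_v\setminus C_v^E$ being kept. Given numbers $x_E$, $E\in\mathcal A(L)$ (probabilities, or more generally elements of any field of characteristic $0$), let $M^T$ be the matrix indexed by $\mathcal L(T)$ with $$M^T(\pi,\pi')=\sum_{E\in\mathcal A(L):\ \widehat\partial_E\pi=\pi'}x_E .$$ For an upset $S$ of $P$ and a family $\alpha=(\alpha_v)$ of set partitions $\alpha_v$ of $C_v$, one for each inner node $v$ of depth different from $d-1$, call $E\in\mathcal A(L)$ *$\alpha$-compatible* if, for each such $v$, every block of $\alpha_v$ is contained in $C_v^E$ or in $C_v\setminus C_v^E$. Put $$\lambda_{(S,\alpha)}=\sum_{\substack{E\in\mathcal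 A(L),\ E\subseteq S\\ E\ \alpha\text{-compatible}}}x_E,\qquad m_{(S,\alpha)}=d_{S_1}\cdots d_{S_k}\prod_{\substack{v\in I\\ \operatorname{depth}(v)\ne d-1}}\ \prod_{B\in\alpha_v}(|B|-1)!,$$ where $S_i=S\cap P_{v_i}$ and $d_{S_i}$ is the derangement number of $S_i$ in the lattice of upsets of $P_{v_i}$ ordered by inclusion: $$d_{S_i}=\sum_{U\supseteq S_i}\mu(S_i,U)\,f([U,P_{v_i}]),$$ with $\mu$ the Möbius function of this lattice and $f([U,P_{v_i}])$ the number of maximal chains in the interval $[U,P_{v_i}]$. Then every $m_{(S,\alpha)}$ is a non-negative integer, and the eigenvalues of $M^T$, counted with algebraic multiplicity, are exactly the $\lambda_{(S,\alpha)}$ with multiplicities $m_{(S,\alpha)}$: $$\det(X\cdot\mathrm{Id}-M^T)=\prod_{(S,\alpha)}\bigl(X-\lambda_{(S,\alpha)}\bigr)^{m_{(S,\alpha)}} .$$ In particular, $\mu$ is an eigenvalue of $M^T$ if and only if $\mu=\lambda_{(S,\alpha)}$ for some $(S,\alpha)$ with $m_{(S,\alpha)}>0$. -/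

import Mathlib

open scoped Classical

noncomputable section

namespace TreeShuffle

/-! ### Total orderings, linear extensions, extended promotion, pop shuffles -/

section Orderings

variable {α : Type*}

/-- The total orderings `π₁ π₂ ⋯ πₙ` of a set, written as words that contain every element
exactly once. -/
abbrev TotalOrdering (α : Type*) : Type _ :=
  {l : List α // l.Nodup ∧ ∀ a, a ∈ l}

/-- The linear extensions `π₁ π₂ ⋯ πₙ` of a poset: words that contain every element exactly once
and in which an earlier letter is never greater than a later one, that is, `πᵢ ≺ πⱼ` implies
`i < j`. -/
abbrev LinExt (α : Type*) [PartialOrder α] : Type _ :=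
  {l : List α // (l.Nodup ∧ ∀ a, a ∈ l) ∧ l.Pairwise (fun a b => ¬ b < a)}

/-- The operator `τ` at the position `i`, on words: interchange the letters in the positions
`i` and `i + 1` if they are incomparable, and do nothing otherwise. Positions are counted
from `0`. -/
def tauWord [PartialOrder α] : ℕ → List α → List α
  | 0, a :: b :: l => if IncompRel (· ≤ ·) a b then b :: a :: l else a :: b :: l
  | i + 1, a :: l => a :: tauWord i l
  | _, l => l

theorem tauWord_perm [PartialOrder α] (i : ℕ) (l : List α) : (tauWord i l).Perm l := by
  fun_induction tauWord i l with
  | case1 a b l h => exact List.Perm.swap _ _ _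
  | case2 a b l h => exact List.Perm.refl _
  | case3 i a l ih => exact ih.cons a
  | case4 => exact List.Perm.refl _

theorem tauWord_pairwise [PartialOrder α] (i : ℕ) (l : List α)
    (hl : l.Pairwise (fun a b => ¬ b < a)) :
    (tauWord i l).Pairwise (fun a b => ¬ b < a) := by
  fun_induction tauWord i l with
  | case1 a b l h =>
    simp only [List.pairwise_cons, List.mem_cons, forall_eq_or_imp] at hl ⊢
    exact ⟨⟨fun h' => h.1 h'.le, hl.2.1⟩, hl.1.2, hl.2.2⟩
  | case2 a b l h => exact hl
  | case3 i a l ih =>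
    rw [List.pairwise_cons] at hl ⊢
    exact ⟨fun c hc => hl.1 c ((tauWord_perm i l).subset hc), ih hl.2⟩
  | case4 => exact hl

/-- The operator `τ` at the position `i` (counted from `0`) on linear extensions. -/
def tau [PartialOrder α] (i : ℕ) (π : LinExt α) : LinExt α :=
  ⟨tauWord i π.1,
    ⟨(tauWord_perm i π.1).nodup_iff.2 π.2.1.1,
      fun a => (tauWord_perm i π.1).mem_iff.2 (π.2.1.2 a)⟩,
    tauWord_pairwise i π.1 π.2.2⟩

/-- The promotion operator `∂` from the position `i` (counted from `0`): apply `τ` at the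
positions `i`, `i + 1`, …, `n - 2`, in this order, where `n` is the number of letters. -/
def promoteFrom [PartialOrder α] (i : ℕ) (π : LinExt α) : LinExt α :=
  (List.range' i (π.1.length - 1 - i)).foldl (fun σ j => tau j σ) π

/-- The extended promotion operator of the element `a`: promotion from the position of `a`. -/
def promote [PartialOrder α] (a : α) (π : LinExt α) : LinExt α :=
  promoteFrom (π.1.idxOf a) π

/-- Extended promotion by a set with at most one element: a singleton `{a}` promotes `a`, and the
empty set acts as the identity. (Other sets do not occur below.) -/
def promoteSet [PartialOrder α] (s : Finset α) (π : LinExt α) : LinExt α :=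
  if h : ∃ a, s = {a} then promote h.choose π else π

/-- The pop shuffle by the ordered partition `(sᶜ, s)`: the elements of `s` are moved to the
back, and the original order within `s` and within its complement is preserved. -/
def moveToBack (s : Finset α) (π : TotalOrdering α) : TotalOrdering α :=
  ⟨π.1.filter (fun a => a ∉ s) ++ π.1.filter (fun a => a ∈ s), by
    refine ⟨?_, fun a => ?_⟩
    · refine List.Nodup.append (π.2.1.filter _) (π.2.1.filter _) ?_
      intro a ha hb
      simp only [List.mem_filter, decide_eq_true_eq] at ha hb
      exact ha.2 hb.2
    · by_cases h : a ∈ s <;> simp [h, π.2.2 a]⟩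

instance [Fintype α] : Fintype (TotalOrdering α) :=
  Fintype.ofInjective (fun π => (⟨π.1, π.2.1⟩ : {l : List α // l.Nodup}))
    fun _ _ h => Subtype.ext (by simpa using h)

instance [Fintype α] [PartialOrder α] : Fintype (LinExt α) :=
  Fintype.ofInjective (fun π => (⟨π.1, π.2.1⟩ : TotalOrdering α))
    fun _ _ h => Subtype.ext (by simpa using h)

end Orderings

/-! ### Rooted forests, upsets and derangement numbers -/

/-- A poset is a rooted forest if every element has at most one successor, that is, is covered
by at most one element. -/
def IsRootedForest (α : Type*) [PartialOrder α] : Prop :=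
  ∀ x y z : α, x ⋖ y → x ⋖ z → y = z

/-- The upsets of a poset, ordered by inclusion. -/
abbrev Upset (α : Type*) [PartialOrder α] : Type _ := {S : Set α // IsUpperSet S}

instance {α : Type*} [PartialOrder α] : OrderTop (Upset α) where
  top := ⟨Set.univ, isUpperSet_univ⟩
  le_top S := Set.subset_univ S.1

instance {α : Type*} [PartialOrder α] [Fintype α] : LocallyFiniteOrder (Upset α) :=
  Fintype.toLocallyFiniteOrder

/-- The derangement number of an element `x` of a finite poset with a maximum:
`∑_{y ≥ x} μ(x, y) f([y, 1])`, where `μ` is the Möbius function and `f([y, 1])` is the number of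
maximal chains of the interval from `y` to the maximum. -/
def derangementNumber {Λ : Type*} [PartialOrder Λ] [OrderTop Λ] [Fintype Λ]
    [LocallyFiniteOrder Λ] (x : Λ) : ℤ :=
  ∑ y : Λ with x ≤ y, IncidenceAlgebra.mu ℤ x y * (Nat.card (Flag (Set.Icc y (⊤ : Λ))) : ℤ)

/-! ### The tree

A rooted tree carries its ancestor order: the root is the least element, `v ≤ w` means that `w`
is a descendant of `v` (possibly `v` itself), and `v ⋖ w` means that `w` is a child of `v`. The
depth of a node is its height in this order. -/

variable (T : RootedTree)

/-- The leaves. -/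
abbrev Leaf : Type _ := {v : T // IsMax v}

variable {T} in
/-- The set `C_v` of children of `v`. It is deliberately not an abbreviation, so that it does not
inherit the ancestor order. -/
def Child (v : T) : Type _ := {c : T // v ⋖ c}

variable {T} in
/-- The underlying node of a child. -/
def Child.node {v : T} (c : Child v) : T := c.1

/-- The nodes of depth `d - 1`. -/
abbrev Bottom (d : ℕ) : Type _ := {v : T // Order.height v + 1 = (d : ℕ∞)}

/-- The inner nodes whose depth is not `d - 1`. -/
abbrev Upper (d : ℕ) : Type _ := {v : T // ¬ IsMax v ∧ Order.height v + 1 ≠ (d : ℕ∞)}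

variable [Fintype T]

instance (v : T) : Fintype (Child v) := inferInstanceAs (Fintype {c : T // v ⋖ c})

/-- The family `𝒜(L)` of the sets of leaves that contain no two siblings. -/
def admissible : Finset (Finset (Leaf T)) :=
  {E | ∀ a ∈ E, ∀ b ∈ E, (∃ v : T, v ⋖ a.1 ∧ v ⋖ b.1) → a = b}

variable {T}

/-- The set `C_v^E` of the `E`-related children of `v`: those that have a descendant in `E`. -/
def relatedChildren (E : Finset (Leaf T)) (v : T) : Finset (Child v) :=
  {c | ∃ e ∈ E, c.node ≤ e.1}

/-- The underlying set partition of `(C_v ∖ C_v^E, C_v^E)`, with an empty block omitted. -/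
def relatedPartition (E : Finset (Leaf T)) (v : T) :
    Finpartition (Finset.univ : Finset (Child v)) :=
  Finpartition.ofErase {(relatedChildren E v)ᶜ, relatedChildren E v}
    (by
      rw [Finset.supIndep_iff_pairwiseDisjoint]
      intro a ha b hb hab
      simp only [Finset.coe_insert, Finset.coe_singleton, Set.mem_insert_iff,
        Set.mem_singleton_iff] at ha hb
      rcases ha with rfl | rfl <;> rcases hb with rfl | rfl
      · exact absurd rfl hab
      · exact disjoint_compl_left
      · exact disjoint_compl_right
      · exact absurd rfl hab)
    (by simp [Finset.sup_insert])

variable (T) in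
/-- `Part(T ∖ L)`: a set partition of the children of every inner node of depth other
than `d - 1`. -/
abbrev TreePartition (d : ℕ) : Type _ :=
  ∀ v : Upper T d, Finpartition (Finset.univ : Finset (Child v.1))

/-- `E` is `α`-compatible: `α_v` is a refinement of the partition given by the `E`-related
children, for every inner node `v` of depth other than `d - 1`. -/
def IsCompatible {d : ℕ} (α : TreePartition T d) (E : Finset (Leaf T)) : Prop :=
  ∀ v : Upper T d, α v ≤ relatedPartition E v.1

variable {d : ℕ} [P : ∀ v : Bottom T d, PartialOrder (Child v.1)]

variable (P) in
/-- The set `ℒ(T)` of total orderings of `T`: a linear extension of the leaf poset at every node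
of depth `d - 1`, and an arbitrary total ordering of the children at every other inner node. -/
abbrev TreeOrdering : Type _ :=
  (∀ v : Bottom T d, LinExt (Child v.1)) × (∀ v : Upper T d, TotalOrdering (Child v.1))

variable (T d) in
/-- The disjoint union `P` of the leaf posets. Its order is the standard one on a sigma type:
elements of different leaf posets are incomparable. -/
abbrev LeafPoset : Type _ := Σ v : Bottom T d, Child v.1

/-- The operator of a set `E ∈ 𝒜(L)`: extended promotion by `C_v^E` at the nodes of depth
`d - 1`, and moving the `E`-related children to the back at the other inner nodes. -/
def move (E : Finset (Leaf T)) (π : TreeOrdering P) : TreeOrdering P :=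
  (fun v => promoteSet (relatedChildren E v.1) (π.1 v),
    fun v => moveToBack (relatedChildren E v.1) (π.2 v))

variable {K : Type*} [Field K]

variable (P) in
/-- The transition matrix: the entry at `(π, π')` is the sum of the weights `x E` of the sets
`E ∈ 𝒜(L)` whose operator takes `π` to `π'`. -/
def transitionMatrix (x : Finset (Leaf T) → K) :
    Matrix (TreeOrdering P) (TreeOrdering P) K :=
  Matrix.of fun π π' => ∑ E ∈ admissible T with move E π = π', x E

/-- `E ⊆ S`, for a set of leaves `E` and an upset `S` of `P`. -/
def IsContained (E : Finset (Leaf T)) (S : Upset (LeafPoset T d)) : Prop :=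
  ∀ e ∈ E, ∃ p ∈ S.1, p.2.node = e.1

/-- The part `S ∩ P_v` of an upset `S` of `P`, an upset of `P_v`. -/
def Upset.part (S : Upset (LeafPoset T d)) (v : Bottom T d) : Upset (Child v.1) :=
  ⟨{c | (⟨v, c⟩ : LeafPoset T d) ∈ S.1}, fun _ _ h hc => S.2 (Sigma.mk_le_mk_iff.2 h) hc⟩

/-- The eigenvalue `λ_(S, α)`. -/
def eigval (x : Finset (Leaf T) → K) (S : Upset (LeafPoset T d)) (α : TreePartition T d) : K :=
  ∑ E ∈ admissible T with IsContained E S ∧ IsCompatible α E, x E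

/-- The multiplicity `m_(S, α) = d_{S₁} ⋯ d_{S_k} ∏_v ∏_{B ∈ α_v} (|B| - 1)!`. -/
def mult (S : Upset (LeafPoset T d)) (α : TreePartition T d) : ℤ :=
  (∏ v : Bottom T d, derangementNumber (Upset.part S v)) *
    ∏ v : Upper T d, ∏ B ∈ (α v).parts, ((B.card - 1).factorial : ℤ)

end TreeShuffle

end

/-! The spectrum is read off from traces of powers. The matrix is a weighted sum of 0-1 matrices of
self-maps, so the trace of its `k`-th power is a sum over words of `k` operators, each contributing
the product of its weights times its number of fixed points. The heart is `fixCount_move_eq_sum`: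
the fixed points of a word number the sum of `mult S α` over the pairs for which every letter is
contained in `S` and `α`-compatible. Exchanging sums gives `tr (M ^ k) = ∑ m λ ^ k`, and in
characteristic 0 these power sums, with `m ≥ 0`, determine the characteristic polynomial
(`charpoly_eq_of_trace_pow`).

A word acts on each inner node separately, so its fixed point count is a product. At an upper node,
a word of pop shuffles is a stable sort by a key recording membership in its sets. Its fixed points
are the sorted orderings, as many as the permutations preserving the key; grouping these by orbit
partition gives the products of `(|B| - 1)!`.

At a node of depth `d - 1`, promoting `a` in a rooted forest moves each element above `a` to the
place of its successor. Iterating a word of promotions therefore forgets everything but the relative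
order of the elements outside the upset `U` generated by the word (`iterate_wordMap_eq`). So fixed
points correspond to linear extensions of the complement of `U`, these to maximal chains of `[U,
⊤]`, and Möbius inversion gives the sum of the derangement numbers over `S ≥ U`.

Derangement numbers are non-negative by the same trace formula: for suitable weights distinct upsets
have distinct eigenvalues, so each derangement number is the multiplicity of a root. -/

noncomputable section

namespace TreeShuffle

/-! ### Traces of powers and the characteristic polynomial -/

section LinearAlgebra

open Polynomial

variable {n K : Type*} [Fintype n] [DecidableEq n] [Field K]

/-- Both sides are multiplicative in `p`, which splits into a constant and linear factors; for `X -
C c` both are the characteristic polynomial at `c` up to the same sign. -/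
theorem det_aeval_eq_prod_roots [IsAlgClosed K] (A : Matrix n n K) (p : K[X]) :
    (aeval A p).det = (A.charpoly.roots.map fun r => p.eval r).prod := by
  have hcard : A.charpoly.roots.card = Fintype.card n := by
    rw [← (IsAlgClosed.splits A.charpoly).natDegree_eq_card_roots, A.charpoly_natDegree_eq_dim]
  have hlin : ∀ c : K, (aeval A (X - C c)).det =
      (A.charpoly.roots.map fun r => (X - C c : K[X]).eval r).prod := by
    intro c
    have h1 : A.charpoly.eval c = (A.charpoly.roots.map fun r => c - r).prod := by
      conv_lhs => rw [(IsAlgClosed.splits A.charpoly).eq_prod_roots_of_monic A.charpoly_monic]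
      rw [eval_multiset_prod, Multiset.map_map]
      simp
    rw [Matrix.eval_charpoly] at h1
    have h2 : aeval A (X - C c) = -(Matrix.scalar n c - A) := by
      simp [Matrix.algebraMap_eq_diagonal, Matrix.scalar_apply, Pi.algebraMap_def]
    rw [h2, Matrix.det_neg, h1, ← hcard]
    generalize A.charpoly.roots = R
    induction R using Multiset.induction with
    | empty => simp
    | cons a s ih =>
      simp only [Multiset.card_cons, Multiset.map_cons, Multiset.prod_cons] at ih ⊢
      rw [← ih]; simp; ring
  have hC : ∀ c : K, (aeval A (C c)).det =
      (A.charpoly.roots.map fun r => (C c : K[X]).eval r).prod := by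
    intro c
    simp [hcard, Matrix.algebraMap_eq_diagonal, Pi.algebraMap_def]
  have hmul : ∀ p q : K[X],
      (aeval A p).det = (A.charpoly.roots.map fun r => p.eval r).prod →
      (aeval A q).det = (A.charpoly.roots.map fun r => q.eval r).prod →
      (aeval A (p * q)).det = (A.charpoly.roots.map fun r => (p * q).eval r).prod := by
    intro p q hp hq
    simp [hp, hq, Multiset.prod_map_mul]
  have hs := (IsAlgClosed.splits p).eq_prod_roots
  rw [hs]
  refine hmul _ _ (hC _) ?_
  generalize p.roots = R
  induction R using Multiset.induction with
  | empty => simp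
  | cons a s ih =>
    rw [Multiset.map_cons, Multiset.prod_cons]
    exact hmul _ _ (hlin a) ih

theorem trace_pow_eq_sum_roots [IsAlgClosed K] (A : Matrix n n K) (k : ℕ) :
    (A ^ k).trace = (A.charpoly.roots.map fun r => r ^ k).sum := by
  have : Infinite K := IsAlgClosed.instInfinite
  have h : (A ^ k).charpoly = ((A.charpoly.roots.map fun r => r ^ k).map fun r => X - C r).prod := by
    refine Polynomial.funext fun t => ?_
    rw [Matrix.eval_charpoly, eval_multiset_prod, Multiset.map_map, Multiset.map_map]
    -- For this polynomial the determinant is the characteristic polynomial of `A ^ k` at `t`;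
    -- values suffice since `K` is infinite.
    have := det_aeval_eq_prod_roots A (C t - X ^ k)
    simpa [Matrix.algebraMap_eq_diagonal, Matrix.scalar_apply, Pi.algebraMap_def] using this
  rw [Matrix.trace_eq_sum_roots_charpoly, h, roots_multiset_prod_X_sub_C]

/-- By linearity powers may be replaced by any polynomial, and the Lagrange basis polynomial at `c`
isolates `g c`. -/
theorem eq_zero_of_sum_mul_pow_eq_zero (s : Finset K) (g : K → K)
    (h : ∀ k : ℕ, ∑ c ∈ s, g c * c ^ k = 0) : ∀ c ∈ s, g c = 0 := by
  have hp : ∀ p : K[X], ∑ c ∈ s, g c * p.eval c = 0 := by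
    intro p
    simp only [eval_eq_sum_range, Finset.mul_sum]
    rw [Finset.sum_comm]
    refine Finset.sum_eq_zero fun i _ => ?_
    have := congrArg (p.coeff i * ·) (h i)
    simp only [Finset.mul_sum, mul_zero] at this
    rw [← this]
    exact Finset.sum_congr rfl fun c _ => by ring
  intro c hc
  have := hp (Lagrange.basis s id c)
  rw [Finset.sum_eq_single c] at this
  · have hb := Lagrange.eval_basis_self (v := (id : K → K)) Function.injective_id.injOn hc
    simp only [id] at hb
    rwa [hb, mul_one] at this
  · intro b hb hbc
    have := Lagrange.eval_basis_of_ne (v := (id : K → K)) hbc.symm hb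
    simp only [id] at this
    rw [this, mul_zero]
  · exact fun h => absurd hc h

/-- Equal power sums force equal total weight at every value. The exponent `0` is included, so the
value `0` is detected too. Characteristic 0 lifts the equality from `K` to `ℤ`. No sign condition on
`m` is needed, which `nonneg_of_fixCount` exploits. -/
theorem count_roots_charpoly [IsAlgClosed K] [CharZero K] {J : Type*} [Fintype J]
    (A : Matrix n n K) (m : J → ℤ) (l : J → K)
    (h : ∀ k : ℕ, (A ^ k).trace = ∑ j, (m j : K) * l j ^ k) (c : K) :
    (A.charpoly.roots.count c : ℤ) = ∑ j with l j = c, m j := by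
  set R := A.charpoly.roots with hR
  set s : Finset K := R.toFinset ∪ Finset.univ.image l with hs
  have key := eq_zero_of_sum_mul_pow_eq_zero s
    (fun c => (R.count c : K) - ∑ j with l j = c, (m j : K)) (by
      intro k
      simp only [sub_mul, Finset.sum_sub_distrib, sub_eq_zero]
      trans (A ^ k).trace
      · rw [trace_pow_eq_sum_roots, Finset.sum_multiset_map_count, ← hR]
        simp only [nsmul_eq_mul]
        refine (Finset.sum_subset Finset.subset_union_left fun c _ hc => ?_).symm
        simp [Multiset.count_eq_zero_of_notMem (fun h' => hc (Multiset.mem_toFinset.2 h'))]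
      · rw [h, ← Finset.sum_fiberwise_of_maps_to (t := s) (g := l) (by simp [hs])]
        refine Finset.sum_congr rfl fun c _ => ?_
        rw [Finset.sum_mul]
        refine Finset.sum_congr rfl fun j hj => ?_
        rw [(Finset.mem_filter.1 hj).2])
  by_cases hc : c ∈ s
  · have := key c hc
    rw [sub_eq_zero] at this
    exact_mod_cast this
  · simp only [hs, Finset.mem_union, not_or, Multiset.mem_toFinset, Finset.mem_image,
      Finset.mem_univ, true_and, not_exists] at hc
    rw [Multiset.count_eq_zero_of_notMem hc.1, Finset.sum_eq_zero]
    · rfl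
    · intro j hj
      exact absurd (Finset.mem_filter.1 hj).2 (hc.2 j)

theorem charpoly_eq_of_trace_pow [CharZero K] {J : Type*} [Fintype J]
    (A : Matrix n n K) (m : J → ℤ) (hm : ∀ j, 0 ≤ m j) (l : J → K)
    (h : ∀ k : ℕ, (A ^ k).trace = ∑ j, (m j : K) * l j ^ k) :
    A.charpoly = ∏ j, (X - C (l j)) ^ (m j).toNat := by
  let f := algebraMap K (AlgebraicClosure K)
  have : CharZero (AlgebraicClosure K) := charZero_of_injective_algebraMap f.injective
  apply Polynomial.map_injective f f.injective
  have hcount := count_roots_charpoly (A.map f) m (fun j => f (l j)) (by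
    intro k
    have h1 : (A.map f) ^ k = (A ^ k).map f := (map_pow f.mapMatrix A k).symm
    have h2 : ((A ^ k).map f).trace = f (A ^ k).trace := (AddMonoidHom.map_trace f.toAddMonoidHom _).symm
    rw [h1, h2, h]
    simp)
  rw [← Matrix.charpoly_map,
    (IsAlgClosed.splits (A.map f).charpoly).eq_prod_roots_of_monic (Matrix.charpoly_monic _)]
  have hroots : (A.map f).charpoly.roots =
      ∑ j, Multiset.replicate (m j).toNat (f (l j)) := by
    ext c
    rw [Multiset.count_sum']
    zify
    rw [hcount, Finset.sum_filter]
    refine Finset.sum_congr rfl fun j _ => ?_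
    rw [Multiset.count_replicate]
    split_ifs <;> simp [hm j]
  rw [hroots, ← Multiset.coe_mapAddMonoidHom, map_sum, Multiset.prod_sum, Polynomial.map_prod]
  refine Finset.prod_congr rfl fun j _ => ?_
  simp

theorem hasEigenvalue_iff_of_charpoly_eq {J : Type*} [Fintype J] {A : Matrix n n K} {m : J → ℤ}
    {l : J → K} (h : A.charpoly = ∏ j, (X - C (l j)) ^ (m j).toNat) (c : K) :
    Module.End.HasEigenvalue (Matrix.toLin' A) c ↔ ∃ j, 0 < m j ∧ c = l j := by
  rw [Module.End.hasEigenvalue_iff_isRoot_charpoly, Matrix.charpoly_toLin', h, IsRoot.def,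
    eval_prod, Finset.prod_eq_zero_iff]
  refine exists_congr fun j => ?_
  simp [sub_eq_zero, and_comm]

end LinearAlgebra

/-! ### Weighted sums of self-maps -/

section Maps

variable {Ω ι : Type*}

/-- The self-map given by a word of operators; the first letter acts first. -/
def wordMap (f : ι → Ω → Ω) (w : List ι) (a : Ω) : Ω := w.foldl (fun b i => f i b) a

@[simp] theorem wordMap_nil (f : ι → Ω → Ω) (a : Ω) : wordMap f [] a = a := rfl

@[simp] theorem wordMap_cons (f : ι → Ω → Ω) (i : ι) (w : List ι) (a : Ω) :
    wordMap f (i :: w) a = wordMap f w (f i a) := rfl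

variable [Fintype Ω]

/-- The number of fixed points of the self-map given by a word. -/
def fixCount (f : ι → Ω → Ω) (w : List ι) : ℕ :=
  (Finset.univ.filter fun a => wordMap f w a = a).card

/-- The transition matrix of a single self-map. -/
def mapMatrix (K : Type*) [Field K] (f : Ω → Ω) : Matrix Ω Ω K :=
  Matrix.of fun a b => if f a = b then 1 else 0

theorem prod_mapMatrix [DecidableEq Ω] (K : Type*) [Field K] (f : ι → Ω → Ω) (w : List ι) :
    (w.map fun i => mapMatrix K (f i)).prod = mapMatrix K (wordMap f w) := by
  induction w with
  | nil =>
    ext a b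
    rw [List.map_nil, List.prod_nil, Matrix.one_apply, mapMatrix, Matrix.of_apply, wordMap_nil]
    congr
  | cons i w ih =>
    rw [List.map_cons, List.prod_cons, ih]
    ext a b
    rw [Matrix.mul_apply, Finset.sum_eq_single_of_mem (f i a) (Finset.mem_univ _)]
    · simp only [mapMatrix, Matrix.of_apply, if_true, one_mul]
      rfl
    · intro c _ hc
      simp [mapMatrix, hc.symm]

theorem trace_mapMatrix (K : Type*) [Field K] (f : ι → Ω → Ω) (w : List ι) :
    (mapMatrix K (wordMap f w)).trace = fixCount f w := by
  simp [mapMatrix, Matrix.trace, fixCount]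

theorem sum_pow_eq_sum_words {R : Type*} [Ring R] [Fintype ι] (A : ι → R) (k : ℕ) :
    (∑ i, A i) ^ k = ∑ w : Fin k → ι, ((List.ofFn w).map A).prod := by
  induction k with
  | zero => simp
  | succ k ih =>
    rw [pow_succ', ih, ← (Fin.consEquiv fun _ : Fin (k + 1) => ι).sum_comp, Fintype.sum_prod_type,
      Finset.sum_mul]
    refine Finset.sum_congr rfl fun i _ => ?_
    rw [Finset.mul_sum]
    refine Finset.sum_congr rfl fun w _ => ?_
    simp [Fin.consEquiv, List.ofFn_succ]

/-- Both powers expand over words. On the right a word survives for `j` exactly when all its letters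
are good for `j`, so the hypothesis matches the coefficients word by word. -/
theorem trace_pow_sum_mapMatrix [DecidableEq Ω] {K : Type*} [Field K] [Fintype ι] {J : Type*} [Fintype J]
    (f : ι → Ω → Ω) (x : ι → K) (m : J → ℤ) (good : J → ι → Prop)
    (h : ∀ w : List ι, (fixCount f w : ℤ) = ∑ j with ∀ i ∈ w, good j i, m j) (k : ℕ) :
    ((∑ i, x i • mapMatrix K (f i)) ^ k).trace =
      ∑ j, (m j : K) * (∑ i with good j i, x i) ^ k := by
  rw [sum_pow_eq_sum_words, Matrix.trace_sum]
  simp only [Finset.sum_filter, sum_pow_eq_sum_words, Finset.mul_sum]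
  rw [Finset.sum_comm]
  refine Finset.sum_congr rfl fun w _ => ?_
  generalize List.ofFn w = w
  have h2 : ∀ j, (w.map fun i => if good j i then x i else 0).prod =
      if ∀ i ∈ w, good j i then (w.map x).prod else 0 := by
    intro j
    induction w with
    | nil => simp
    | cons i w ih =>
      rw [List.map_cons, List.prod_cons, ih]
      simp only [List.forall_mem_cons]
      by_cases h1 : good j i <;> by_cases h2 : ∀ i ∈ w, good j i <;> simp [h1, h2]
  have h1 : (w.map fun i => x i • mapMatrix K (f i)).prod =
      (w.map x).prod • mapMatrix K (wordMap f w) := by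
    rw [← prod_mapMatrix]
    clear h2
    induction w with
    | nil => simp
    | cons i w ih => simp [ih, smul_smul, mul_comm]
  rw [h1, Matrix.trace_smul, trace_mapMatrix]
  have h3 : (fixCount f w : K) = ((fixCount f w : ℤ) : K) := by simp
  rw [h3, h]
  simp only [h2, smul_eq_mul, Int.cast_sum, Finset.mul_sum, Finset.sum_filter]
  refine Finset.sum_congr rfl fun j _ => ?_
  split_ifs <;> simp [mul_comm]

theorem nonneg_of_fixCount [Fintype ι] {J : Type*} [Fintype J]
    (f : ι → Ω → Ω) (m : J → ℤ) (good : J → ι → Prop) (hgood : Function.Injective good)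
    (h : ∀ w : List ι, (fixCount f w : ℤ) = ∑ j with ∀ i ∈ w, good j i, m j) (j : J) :
    0 ≤ m j := by
  -- With distinct powers of two as weights, the sum over the good letters encodes that set in
  -- binary; as `good` is injective, distinct indices get distinct eigenvalues.
  let x : ι → ℂ := fun i => ((2 ^ (Fintype.equivFin ι i : ℕ) : ℕ) : ℂ)
  have hc := count_roots_charpoly _ m (fun j => ∑ i with good j i, x i)
    (trace_pow_sum_mapMatrix f x m good h) (∑ i with good j i, x i)
  have hinj : ∀ j', (∑ i with good j' i, x i) = (∑ i with good j i, x i) → j' = j := by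
    intro j' hj'
    let e : ι ↪ ℕ := (Fintype.equivFin ι).toEmbedding.trans Fin.valEmbedding
    have h1 : ∀ j', (∑ i with good j' i, x i) =
        ((∑ k ∈ (Finset.univ.filter (good j')).map e, 2 ^ k : ℕ) : ℂ) := by
      intro j'
      rw [Finset.sum_map]
      simp [x, e]
    rw [h1, h1] at hj'
    have h2 := Finset.map_injective e (Finset.geomSum_injective le_rfl (Nat.cast_injective hj'))
    apply hgood
    funext i
    have := congrArg (i ∈ ·) h2
    simpa using this
  rw [Finset.sum_eq_single_of_mem j (by simp)] at hc
  · rw [← hc]; positivity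
  · intro j' hj' hne
    exact absurd (hinj j' (Finset.mem_filter.1 hj').2) hne

end Maps

/-! ### The order of the letters of a word -/

section Words

variable {α : Type*}

/-- The letter `x` has an occurrence in front of an occurrence of `y`. -/
def Before : List α → α → α → Prop
  | [], _, _ => False
  | c :: l, x, y => (c = x ∧ y ∈ l) ∨ Before l x y

@[simp] theorem before_nil (x y : α) : ¬ Before [] x y := id

@[simp] theorem before_cons (c : α) (l : List α) (x y : α) :
    Before (c :: l) x y ↔ (c = x ∧ y ∈ l) ∨ Before l x y := Iff.rfl

theorem Before.mem_left {l : List α} {x y : α} (h : Before l x y) : x ∈ l := by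
  induction l with
  | nil => exact h.elim
  | cons c l ih =>
    rcases h with h | h
    · simp [h.1]
    · exact List.mem_cons_of_mem _ (ih h)

theorem Before.mem_right {l : List α} {x y : α} (h : Before l x y) : y ∈ l := by
  induction l with
  | nil => exact h.elim
  | cons c l ih =>
    rcases h with h | h
    · exact List.mem_cons_of_mem _ h.2
    · exact List.mem_cons_of_mem _ (ih h)

theorem before_append (l l' : List α) (x y : α) :
    Before (l ++ l') x y ↔ Before l x y ∨ Before l' x y ∨ (x ∈ l ∧ y ∈ l') := by
  induction l with
  | nil => simp
  | cons c l ih => simp only [List.cons_append, before_cons, List.mem_append, ih, List.mem_cons]; grind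

theorem before_filter (p : α → Bool) (l : List α) (x y : α) :
    Before (l.filter p) x y ↔ p x ∧ p y ∧ Before l x y := by
  induction l with
  | nil => simp
  | cons c l ih =>
    rw [List.filter_cons]
    split_ifs with h
    · simp only [before_cons, ih, List.mem_filter]; grind
    · simp only [before_cons, ih]; grind

theorem Before.asymm {l : List α} (hl : l.Nodup) {x y : α} (h : Before l x y) :
    ¬ Before l y x := by
  induction l with
  | nil => exact h.elim
  | cons c l ih =>
    rw [List.nodup_cons] at hl
    rintro (h' | h') <;> rcases h with h | h
    · exact hl.1 (h'.1.symm ▸ h.2)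
    · exact hl.1 (h'.1 ▸ h.mem_right)
    · exact hl.1 (h.1 ▸ h'.mem_right)
    · exact ih hl.2 h h'

theorem before_or_before {l : List α} {x y : α} (hx : x ∈ l) (hy : y ∈ l) (hxy : x ≠ y) :
    Before l x y ∨ Before l y x := by
  induction l with
  | nil => simp at hx
  | cons c l ih =>
    simp only [List.mem_cons] at hx hy
    rcases hx with rfl | hx <;> rcases hy with rfl | hy
    · exact absurd rfl hxy
    · exact Or.inl (Or.inl ⟨rfl, hy⟩)
    · exact Or.inr (Or.inl ⟨rfl, hx⟩)
    · exact (ih hx hy).imp Or.inr Or.inr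

theorem pairwise_iff_before {R : α → α → Prop} {l : List α} :
    l.Pairwise R ↔ ∀ x y, Before l x y → R x y := by
  induction l with
  | nil => simp
  | cons c l ih =>
    rw [List.pairwise_cons, ih]
    simp only [before_cons]
    constructor
    · rintro ⟨h1, h2⟩ x y (⟨rfl, h⟩ | h)
      · exact h1 _ h
      · exact h2 _ _ h
    · exact fun h => ⟨fun a ha => h _ _ (Or.inl ⟨rfl, ha⟩), fun x y hxy => h _ _ (Or.inr hxy)⟩

theorem eq_of_before_iff {l l' : List α} (hl : l.Nodup) (hp : l.Perm l')
    (h : ∀ x y, Before l x y ↔ Before l' x y) : l = l' := by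
  induction l generalizing l' with
  | nil => exact hp.nil_eq
  | cons a t ih =>
    cases l' with
    | nil => exact absurd hp.length_eq (by simp)
    | cons b t' =>
      have hl' := hp.nodup_iff.1 hl
      rw [List.nodup_cons] at hl hl'
      have hab : a = b := by
        by_contra hab
        have ha : a ∈ t' := by
          have := hp.subset (List.mem_cons_self : a ∈ a :: t)
          simpa [hab] using this
        rcases (h b a).2 (Or.inl ⟨rfl, ha⟩) with h' | h'
        · exact hab h'.1
        · exact hl.1 h'.mem_right
      subst hab
      have hp' := (List.perm_cons a).1 hp
      rw [ih hl.2 hp' fun x y => ?_]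
      by_cases hx : a = x
      · subst hx
        exact ⟨fun h' => absurd h'.mem_left hl.1, fun h' => absurd h'.mem_left hl'.1⟩
      · simpa [hx] using h x y

theorem TotalOrdering.ext_before {π π' : TotalOrdering α}
    (h : ∀ x y, Before π.1 x y ↔ Before π'.1 x y) : π = π' :=
  Subtype.ext (eq_of_before_iff π.2.1
    ((List.perm_ext_iff_of_nodup π.2.1 π'.2.1).2 fun a => by simp [π.2.2 a, π'.2.2 a]) h)

end Words

theorem fixCount_eq_card {Ω ι : Type*} [Fintype Ω] (f : ι → Ω → Ω) (w : List ι) :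
    fixCount f w = Nat.card {a // wordMap f w a = a} := by
  rw [fixCount, Nat.card_eq_fintype_card, Fintype.card_subtype]

/-! ### Promotion as sliding -/

section Slide

variable {α : Type*} [PartialOrder α]

/-- The word obtained from `a :: l` by extended promotion from its first position. -/
def slide : α → List α → List α
  | a, [] => [a]
  | a, b :: l => if IncompRel (· ≤ ·) a b then b :: slide a l else a :: slide b l

theorem tauWord_append_cons (p l : List α) (a b : α) :
    tauWord p.length (p ++ a :: b :: l) =
      p ++ if IncompRel (· ≤ ·) a b then b :: a :: l else a :: b :: l := by
  induction p with
  | nil => simp [tauWord]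
  | cons c p ih => simp [tauWord, ih]

/-- One letter travels at a time: it passes incomparable letters, and on meeting a comparable one it
stops and that letter travels on. -/
theorem foldl_tauWord (p l : List α) (a : α) :
    (List.range' p.length l.length).foldl (fun σ j => tauWord j σ) (p ++ a :: l) =
      p ++ slide a l := by
  induction l generalizing p a with
  | nil => simp [slide]
  | cons b l ih =>
    rw [List.length_cons, List.range'_succ, List.foldl_cons, tauWord_append_cons, slide]
    split_ifs
    · simpa using ih (p ++ [b]) a
    · simpa using ih (p ++ [a]) b

theorem promoteFrom_val (i : ℕ) (π : LinExt α) :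
    (promoteFrom i π).1 =
      (List.range' i (π.1.length - 1 - i)).foldl (fun σ j => tauWord j σ) π.1 := by
  unfold promoteFrom
  generalize List.range' i (π.1.length - 1 - i) = r
  induction r generalizing π with
  | nil => rfl
  | cons j r ih => exact ih (tau j π)

theorem promote_val (a : α) (π : LinExt α) :
    ∃ p l, π.1 = p ++ a :: l ∧ (promote a π).1 = p ++ slide a l := by
  obtain ⟨p, l, h⟩ := List.append_of_mem (π.2.1.2 a)
  have hnd := π.2.1.1
  refine ⟨p, l, h, ?_⟩
  have ha : a ∉ p := by
    rw [h] at hnd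
    exact fun ha => (List.disjoint_of_nodup_append hnd) ha List.mem_cons_self
  rw [promote, promoteFrom_val, h, List.idxOf_append_of_notMem ha, List.idxOf_cons_self,
    ← foldl_tauWord]
  congr 2
  simp

theorem slide_perm (a : α) (l : List α) : (slide a l).Perm (a :: l) := by
  induction l generalizing a with
  | nil => rfl
  | cons b l ih =>
    rw [slide]
    split_ifs
    · exact ((ih a).cons b).trans (List.Perm.swap _ _ _)
    · exact (ih b).cons a

/-- Every travelling letter is `≥ a`, so letters rejected by this condition are never exchanged with
one another. -/
theorem filter_slide (p : α → Bool) (a : α) (l : List α) (hp : ∀ c, a ≤ c → p c = false)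
    (hl : (a :: l).Pairwise fun a b => ¬ b < a) : (slide a l).filter p = (a :: l).filter p := by
  induction l generalizing a with
  | nil => rfl
  | cons b l ih =>
    rw [slide]
    split_ifs with hab
    · rw [List.filter_cons, ih a hp (hl.sublist (by simp))]
      simp [List.filter_cons, hp a le_rfl]
    · have hle : a ≤ b := by
        by_contra hle
        refine hab ⟨hle, fun hba => ?_⟩
        exact (List.pairwise_cons.1 hl).1 b (by simp) (lt_of_le_not_ge hba hle)
      rw [List.filter_cons, ih b (fun c hc => hp c (hle.trans hc)) (List.pairwise_cons.1 hl).2,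
        List.filter_cons (x := a)]

/-- In a forest the elements above `a` form a chain of covers, and the travelling letter is handed
along it. So each element takes the place of its successor, and the top one, for which no `z`
exists, goes to the end. -/
theorem before_slide [Finite α] (hα : IsRootedForest α) {a : α} {l : List α}
    (hl : (a :: l).Pairwise fun a b => ¬ b < a) (hnd : (a :: l).Nodup)
    (habove : ∀ c, a < c → c ∈ l) {x y : α} (hx : a ≤ x) (hy : ¬ a ≤ y) :
    Before (slide a l) x y ↔ ∃ z, x ⋖ z ∧ Before l z y := by
  induction l generalizing a with
  | nil => simp [slide]
  | cons b l ih =>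
    have hb : b ∉ l := (List.nodup_cons.1 (List.nodup_cons.1 hnd).2).1
    have hba : b ≠ a := fun h => (List.nodup_cons.1 hnd).1 (by simp [h])
    rw [slide]
    split_ifs with hab
    · have hbx : b ≠ x := by rintro rfl; exact hab.1 hx
      have h1 := ih (hl.sublist (by simp)) (hnd.sublist (by simp))
        (fun c hc => by
          rcases List.mem_cons.1 (habove c hc) with rfl | h
          · exact absurd hc.le hab.1
          · exact h) hx hy
      simp only [before_cons, hbx, false_and, false_or, h1]
      refine exists_congr fun z => and_congr_right fun hz => ?_
      have hzb : b ≠ z := by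
        rintro rfl
        exact hab.1 (hx.trans hz.le)
      simp [hzb]
    · have hle : a ≤ b := by
        by_contra hle
        refine hab ⟨hle, fun h => ?_⟩
        exact (List.pairwise_cons.1 hl).1 b (by simp) (lt_of_le_not_ge h hle)
      have hlt : a < b := lt_of_le_of_ne hle hba.symm
      have hlb := (List.pairwise_cons.1 hl).2
      -- An element strictly between would occur in `l`, hence behind `b` although smaller than `b`.
      have hcov : a ⋖ b := by
        refine ⟨hlt, fun c hac hcb => ?_⟩
        rcases List.mem_cons.1 (habove c hac) with rfl | h
        · exact hcb.false
        · exact (List.pairwise_cons.1 hlb).1 c h hcb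
      have hyb : y ≠ b := by rintro rfl; exact hy hle
      have hya : y ≠ a := by rintro rfl; exact hy le_rfl
      have hup : ∀ c, a < c → b ≤ c := by
        intro c hc
        obtain ⟨e, he, hec⟩ := exists_covBy_le_of_lt hc
        rwa [hα a b e hcov he]
      rcases eq_or_lt_of_le hx with rfl | hax
      · have h2 : ¬ Before (slide b l) a y := fun h =>
          (List.nodup_cons.1 hnd).1 ((slide_perm b l).subset h.mem_left)
        have h3 : y ∈ slide b l ↔ y ∈ l := by simp [(slide_perm b l).mem_iff, hyb]
        simp only [before_cons, true_and, h2, or_false, h3]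
        constructor
        · exact fun h => ⟨b, hcov, Or.inl ⟨rfl, h⟩⟩
        · rintro ⟨z, -, ⟨-, h⟩ | h⟩
          · exact h
          · exact h.mem_right
      · have h1 := ih hlb (List.nodup_cons.1 hnd).2
          (fun c hc => by
            rcases List.mem_cons.1 (habove c (hlt.trans hc)) with rfl | h
            · exact absurd hc (lt_irrefl _)
            · exact h) (hup x hax) (fun h => hy (hle.trans h))
        simp only [before_cons, hax.ne, false_and, false_or, h1]
        refine exists_congr fun z => and_congr_right fun hz => ?_
        have hzb : b ≠ z := by
          rintro rfl
          exact hz.lt.not_ge (hup x hax)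
        simp [hzb]

/-! ### Relative order of two elements under promotion -/

theorem LinExt.ext_before {π π' : LinExt α} (h : ∀ x y, Before π.1 x y ↔ Before π'.1 x y) :
    π = π' := by
  have h1 : (⟨π.1, π.2.1⟩ : TotalOrdering α) = ⟨π'.1, π'.2.1⟩ := TotalOrdering.ext_before h
  exact Subtype.ext (Subtype.mk.inj h1)

theorem before_iff_lt (π : LinExt α) {x y : α} (h : x ≤ y ∨ y ≤ x) :
    Before π.1 x y ↔ x < y := by
  have hp := pairwise_iff_before.1 π.2.2
  constructor
  · intro hb
    have hne : x ≠ y := by rintro rfl; exact hb.asymm π.2.1.1 hb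
    rcases h with h | h
    · exact lt_of_le_of_ne h hne
    · exact absurd (lt_of_le_of_ne h hne.symm) (hp _ _ hb)
  · intro hlt
    rcases before_or_before (π.2.1.2 x) (π.2.1.2 y) hlt.ne with h | h
    · exact h
    · exact absurd hlt (hp _ _ h)

theorem before_comm_not (π : LinExt α) {x y : α} (h : x ≠ y) :
    Before π.1 x y ↔ ¬ Before π.1 y x := by
  constructor
  · exact fun h' => h'.asymm π.2.1.1
  · exact fun h' => (before_or_before (π.2.1.2 x) (π.2.1.2 y) h).resolve_right h'

theorem filter_promote (p : α → Bool) (a : α) (π : LinExt α) (hp : ∀ c, a ≤ c → p c = false) :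
    (promote a π).1.filter p = π.1.filter p := by
  obtain ⟨q, l, h1, h2⟩ := promote_val a π
  have h3 := π.2.2
  rw [h1] at h3
  rw [h1, h2, List.filter_append, List.filter_append,
    filter_slide p a l hp (List.pairwise_append.1 h3).2.1]

theorem before_promote_of_not_le {a x y : α} (π : LinExt α) (hx : ¬ a ≤ x) (hy : ¬ a ≤ y) :
    Before (promote a π).1 x y ↔ Before π.1 x y := by
  have h := before_filter (fun c => decide ¬ a ≤ c) (promote a π).1 x y
  rw [filter_promote _ a π (by simp), before_filter] at h
  simpa [hx, hy] using h.symm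

/-- The upset generated by the letters of a word. -/
def wordUpset (w : List α) : Upset α :=
  ⟨{x | ∃ a ∈ w, a ≤ x}, fun _ _ hxy ⟨a, ha, hax⟩ => ⟨a, ha, hax.trans hxy⟩⟩

theorem filter_wordMap_promote (w : List α) (π : LinExt α) :
    (wordMap promote w π).1.filter (fun x => decide (x ∉ (wordUpset w).1)) =
      π.1.filter (fun x => decide (x ∉ (wordUpset w).1)) := by
  have : ∀ v : List α, (∀ a ∈ v, a ∈ w) → ∀ π : LinExt α,
      (wordMap promote v π).1.filter (fun x => decide (x ∉ (wordUpset w).1)) =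
        π.1.filter (fun x => decide (x ∉ (wordUpset w).1)) := by
    intro v hv
    induction v with
    | nil => exact fun _ => rfl
    | cons a v ih =>
      intro π
      rw [wordMap_cons, ih (fun b hb => hv b (by simp [hb])), filter_promote]
      intro c hc
      have hc' : c ∈ (wordUpset w).1 := ⟨a, hv a (by simp), hc⟩
      simp [hc']
  exact this w (fun _ h => h) π

variable [Fintype α]

theorem before_promote_of_le (hα : IsRootedForest α) {a x y : α} (π : LinExt α) (hx : a ≤ x)
    (hy : ¬ a ≤ y) : Before (promote a π).1 x y ↔ ∃ z, x ⋖ z ∧ Before π.1 z y := by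
  obtain ⟨q, l, h1, h2⟩ := promote_val a π
  have h3 := π.2.2
  have hnd := π.2.1.1
  have hmem := π.2.1.2
  rw [h1] at h3 hnd hmem
  rw [List.pairwise_append] at h3
  have hq : ∀ c, a ≤ c → c ∉ q := by
    intro c hac hc
    rcases eq_or_lt_of_le hac with rfl | hac
    · exact (List.disjoint_of_nodup_append hnd) hc List.mem_cons_self
    · exact h3.2.2 c hc a List.mem_cons_self hac
  have habove : ∀ c, a < c → c ∈ l := by
    intro c hac
    have := hmem c
    simpa [hq c hac.le, hac.ne'] using this
  have key := before_slide hα h3.2.1 hnd.of_append_right habove hx hy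
  have hxq : ¬ Before q x y := fun h => hq x hx h.mem_left
  rw [h1, h2, before_append]
  simp only [hxq, hq x hx, false_and, or_false, false_or, key]
  refine exists_congr fun z => and_congr_right fun hz => ?_
  have haz : a < z := hx.trans_lt hz.lt
  rw [before_append, before_cons]
  have hzq : ¬ Before q z y := fun h => hq z haz.le h.mem_left
  simp [hzq, hq z haz.le, haz.ne]

/-! ### Fixed points of words of promotions -/

/-- The number of elements above `x`. -/
def rank (x : α) : ℕ := (Finset.univ.filter fun z => x ≤ z).card

theorem rank_pos (x : α) : 0 < rank x := Finset.card_pos.2 ⟨x, by simp⟩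

theorem rank_lt {x y : α} (h : x < y) : rank y < rank x := by
  refine Finset.card_lt_card ⟨fun z hz => ?_, fun hs => ?_⟩
  · simp only [Finset.mem_filter, Finset.mem_univ, true_and] at hz ⊢
    exact h.le.trans hz
  · have := hs (show x ∈ _ by simp)
    simp only [Finset.mem_filter, Finset.mem_univ, true_and] at this
    exact h.not_ge this

theorem IsRootedForest.total_above (hα : IsRootedForest α) {a x y : α} (hx : a ≤ x)
    (hy : a ≤ y) : x ≤ y ∨ y ≤ x := by
  induction h : rank a using Nat.strong_induction_on generalizing a with
  | _ n ih =>
    rcases eq_or_lt_of_le hx with rfl | hx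
    · exact Or.inl hy
    rcases eq_or_lt_of_le hy with rfl | hy
    · exact Or.inr hx.le
    obtain ⟨b, hb, hbx⟩ := exists_covBy_le_of_lt hx
    obtain ⟨c, hc, hcy⟩ := exists_covBy_le_of_lt hy
    obtain rfl := hα a b c hb hc
    exact ih _ (h ▸ rank_lt hb.lt) hbx hcy rfl

/-- Two linear extensions order `x` and `y` in the same way whenever both elements are outside
`A`, or their total rank is at most `k`, or it is `k + 1` and one of them is in `B`. -/
def Agree (A B : Set α) (k : ℕ) (π π' : LinExt α) : Prop :=
  ∀ x y, ((x ∉ A ∧ y ∉ A) ∨ rank x + rank y ≤ k ∨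
    (rank x + rank y ≤ k + 1 ∧ (x ∈ B ∨ y ∈ B))) → (Before π.1 x y ↔ Before π'.1 x y)

/-- If only `x` is above `a`, its new order relative to `y` is the old order of its successor
relative to `y`, a pair of smaller total rank: this is the gain from `k` to `k + 1`. Two elements
above `a` are comparable, so their order is forced; two elements not above `a` keep their order. -/
theorem agree_promote (hα : IsRootedForest α) {A B : Set α} (hA : IsUpperSet A) {k : ℕ}
    {π π' : LinExt α} (h : Agree A B k π π') {a : α} (ha : a ∈ A) :
    Agree A (B ∪ Set.Ici a) k (promote a π) (promote a π') := by
  have main : ∀ x y, a ≤ x → ¬ a ≤ y → rank x + rank y ≤ k + 1 →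
      (Before (promote a π).1 x y ↔ Before (promote a π').1 x y) := by
    intro x y hx hy hr
    rw [before_promote_of_le hα π hx hy, before_promote_of_le hα π' hx hy]
    refine exists_congr fun z => and_congr_right fun hz => h z y ?_
    have := rank_lt hz.lt
    right; left; omega
  intro x y hxy
  by_cases hx : a ≤ x <;> by_cases hy : a ≤ y
  · obtain hc | hc : x ≤ y ∨ y ≤ x := hα.total_above hx hy
    · rw [before_iff_lt _ (Or.inl hc), before_iff_lt _ (Or.inl hc)]
    · rw [before_iff_lt _ (Or.inr hc), before_iff_lt _ (Or.inr hc)]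
  · refine main x y hx hy ?_
    rcases hxy with h | h | h
    · exact absurd (hA hx ha) h.1
    · omega
    · exact h.1
  · have hne : x ≠ y := by rintro rfl; exact hx hy
    rw [before_comm_not _ hne, before_comm_not _ hne]
    refine not_congr (main y x hy hx ?_)
    rcases hxy with h | h | h
    · exact absurd (hA hy ha) h.2
    · omega
    · omega
  · rw [before_promote_of_not_le _ hx hy, before_promote_of_not_le _ hx hy]
    refine h x y (hxy.imp_right (Or.imp_right (And.imp_right ?_)))
    simp [hx, hy]

theorem agree_wordMap (hα : IsRootedForest α) {A B : Set α} (hA : IsUpperSet A) {k : ℕ}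
    {π π' : LinExt α} (h : Agree A B k π π') {w : List α} (hw : ∀ a ∈ w, a ∈ A) :
    Agree A (B ∪ (wordUpset w).1) k (wordMap promote w π) (wordMap promote w π') := by
  induction w generalizing B π π' with
  | nil =>
    simpa [wordUpset] using h
  | cons a w ih =>
    have := ih (agree_promote hα hA h (hw a (by simp))) fun b hb => hw b (by simp [hb])
    rw [wordMap_cons, wordMap_cons]
    convert this using 1
    ext x
    simp [wordUpset, or_assoc]

/-- After the whole word, `B` has grown to the full upset `A`, so every pair of total rank `k + 1`
either meets `B` or lies outside `A`. -/
theorem agree_wordMap_succ (hα : IsRootedForest α) {w : List α} {k : ℕ} {π π' : LinExt α}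
    (h : Agree (wordUpset w).1 ∅ k π π') :
    Agree (wordUpset w).1 ∅ (k + 1) (wordMap promote w π) (wordMap promote w π') := by
  have h1 := agree_wordMap hα (wordUpset w).2 h (w := w) fun a ha => ⟨a, ha, le_rfl⟩
  intro x y hxy
  by_cases hx : x ∈ (wordUpset w).1 ∨ y ∈ (wordUpset w).1
  · refine h1 x y (Or.inr (Or.inr ⟨?_, ?_⟩))
    · rcases hxy with h | h | h
      · tauto
      · exact h
      · simp at h
    · simpa using hx
  · exact h1 x y (Or.inl (not_or.1 hx))

theorem iterate_wordMap_eq (hα : IsRootedForest α) (w : List α) {π π' : LinExt α}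
    (h : π.1.filter (fun x => decide (x ∉ (wordUpset w).1)) =
      π'.1.filter (fun x => decide (x ∉ (wordUpset w).1))) :
    -- Each rank is at most the cardinality, so twice the cardinality bounds every total rank;
    -- agreement starts at `k = 0`, where positivity of ranks leaves only pairs outside the upset.
    (wordMap promote w)^[2 * Fintype.card α] π = (wordMap promote w)^[2 * Fintype.card α] π' := by
  have hk : ∀ k, Agree (wordUpset w).1 ∅ k ((wordMap promote w)^[k] π)
      ((wordMap promote w)^[k] π') := by
    intro k
    induction k with
    | zero =>
      rintro x y (hxy | hxy | hxy)
      · have h1 := before_filter (fun x => decide (x ∉ (wordUpset w).1)) π.1 x y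
        rw [h, before_filter] at h1
        simpa [hxy] using h1.symm
      · have := rank_pos x
        omega
      · simp at hxy
    | succ k ih =>
      rw [Function.iterate_succ_apply', Function.iterate_succ_apply']
      exact agree_wordMap_succ hα ih
  have hr : ∀ x : α, rank x ≤ Fintype.card α := fun x => Finset.card_le_univ _
  refine LinExt.ext_before fun x y => ?_
  refine hk _ x y (Or.inr (Or.inl ?_))
  have := hr x
  have := hr y
  omega

/-- The linear extensions of the complement of an upset. -/
abbrev PartialExt (U : Upset α) : Type _ :=
  {l : List α // l.Nodup ∧ (∀ a, a ∈ l ↔ a ∉ U.1) ∧ l.Pairwise fun a b => ¬ b < a}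

theorem nonempty_linExt : Nonempty (LinExt α) := by
  obtain ⟨r, hr, hle⟩ := extend_partialOrder (α := α) (· ≤ ·)
  refine ⟨⟨Finset.univ.sort r, ⟨Finset.sort_nodup _ _, by simp⟩, ?_⟩⟩
  refine pairwise_iff_before.2 fun a b hab hba => ?_
  have h1 := pairwise_iff_before.1 (Finset.pairwise_sort Finset.univ r) a b hab
  exact hba.ne (antisymm (hle _ _ hba.le) h1)

theorem exists_linExt_filter_eq (U : Upset α) (l : PartialExt U) :
    ∃ π : LinExt α, π.1.filter (fun x => decide (x ∉ U.1)) = l.1 := by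
  obtain ⟨ρ⟩ := nonempty_linExt (α := α)
  obtain ⟨l, hnd, hmem, hp⟩ := l
  refine ⟨⟨l ++ ρ.1.filter (fun x => decide (x ∈ U.1)), ⟨?_, fun a => ?_⟩, ?_⟩, ?_⟩
  · refine List.Nodup.append hnd (ρ.2.1.1.filter _) fun a ha ha' => ?_
    exact (hmem a).1 ha (by simpa using (List.mem_filter.1 ha').2)
  · by_cases h : a ∈ U.1 <;> simp [h, hmem, ρ.2.1.2]
  · refine List.pairwise_append.2 ⟨hp, ρ.2.2.filter _, fun a ha b hb hba => ?_⟩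
    exact (hmem a).1 ha (U.2 hba.le (by simpa using (List.mem_filter.1 hb).2))
  · rw [List.filter_append, List.filter_filter, List.filter_eq_self.2 (by simp [hmem])]
    simp

theorem fixCount_promote (hα : IsRootedForest α) (w : List α) :
    fixCount promote w = Nat.card (PartialExt (wordUpset w)) := by
  rw [fixCount_eq_card]
  refine Nat.card_eq_of_bijective (fun π => ⟨π.1.1.filter fun x => decide (x ∉ (wordUpset w).1),
    π.1.2.1.1.filter _, fun a => by simp [π.1.2.1.2], π.1.2.2.filter _⟩) ⟨?_, ?_⟩
  · intro π π' h
    have h1 := iterate_wordMap_eq hα w (congrArg Subtype.val h)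
    rw [Function.iterate_fixed π.2, Function.iterate_fixed π'.2] at h1
    exact Subtype.ext h1
  · intro l
    obtain ⟨π, hπ⟩ := exists_linExt_filter_eq _ l
    have hfilter : ∀ k, ((wordMap promote w)^[k] π).1.filter
        (fun x => decide (x ∉ (wordUpset w).1)) = l.1 := by
      intro k
      induction k with
      | zero => exact hπ
      | succ k ih => rw [Function.iterate_succ_apply', filter_wordMap_promote, ih]
    refine ⟨⟨(wordMap promote w)^[2 * Fintype.card α] π, ?_⟩, Subtype.ext (hfilter _)⟩
    -- Applying the word once more amounts to starting from `wordMap promote w π`, which has the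
    -- same restriction to the complement as `π`; hence the iterate is fixed.
    rw [← Function.iterate_succ_apply' (wordMap promote w), Function.iterate_succ_apply]
    exact iterate_wordMap_eq hα w (filter_wordMap_promote w π)

end Slide

/-! ### Maximal chains of upsets -/

section Flags

/-- The sets of letters of the suffixes recover the word from its end: consecutive sets differ by
one letter. This makes the passage from words to chains injective. -/
theorem suffix_of_suffix_mem {α : Type*} {l l' : List α} (hl : l.Nodup) (hl' : l'.Nodup)
    (h : ∀ t, t <:+ l → ∃ t', t' <:+ l' ∧ ∀ x, x ∈ t ↔ x ∈ t') : l <:+ l' := by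
  induction l with
  | nil => exact List.nil_suffix
  | cons a l ih =>
    have h1 := ih (List.nodup_cons.1 hl).2 fun t ht => h t (ht.trans (List.suffix_cons a l))
    obtain ⟨t', ht', hmem⟩ := h (a :: l) List.suffix_rfl
    have hp : (a :: l).Perm t' :=
      (List.perm_ext_iff_of_nodup hl (hl'.sublist ht'.sublist)).2 hmem
    have hlen : l.length + 1 = t'.length := by simpa using hp.length_eq
    obtain ⟨p, rfl⟩ := List.suffix_of_suffix_length_le h1 ht' (by omega)
    obtain ⟨c, rfl⟩ := List.length_eq_one_iff.1 (show p.length = 1 by simp at hlen; omega)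
    obtain rfl : a = c := by
      have := hp.subset (List.mem_cons_self : a ∈ a :: l)
      simpa [(List.nodup_cons.1 hl).1] using this
    exact ht'

variable {α : Type*} [PartialOrder α]

/-- The chain of upsets obtained by adding the letters of `l` to `U`, the last one first. -/
def suffixChain (U : Upset α) (l : List α) : Set (Set.Icc U (⊤ : Upset α)) :=
  {W | ∃ t, t <:+ l ∧ W.1.1 = U.1 ∪ {x | x ∈ t}}

theorem PartialExt.isUpperSet_union {U : Upset α} (l : PartialExt U) {t : List α}
    (ht : t <:+ l.1) : IsUpperSet (U.1 ∪ {x | x ∈ t}) := by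
  obtain ⟨l, hnd, hmem, hp⟩ := l
  obtain ⟨p, rfl⟩ := ht
  rintro x y hxy (hx | hx)
  · exact Or.inl (U.2 hxy hx)
  · by_cases hy : y ∈ U.1
    · exact Or.inl hy
    · refine Or.inr ?_
      rcases List.mem_append.1 ((hmem y).2 hy) with hy' | hy'
      · rcases eq_or_lt_of_le hxy with rfl | hlt
        · exact hx
        · exact absurd hlt ((List.pairwise_append.1 hp).2.2 y hy' x hx)
      · exact hy'

theorem isMaxChain_suffixChain {U : Upset α} (l : PartialExt U) :
    IsMaxChain (· ≤ ·) (suffixChain U l.1) := by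
  constructor
  · rintro V ⟨t, ht, hV⟩ W ⟨t', ht', hW⟩ -
    have hle : ∀ {V W : Set.Icc U (⊤ : Upset α)} {t t' : List α}, V.1.1 = U.1 ∪ {x | x ∈ t} →
        W.1.1 = U.1 ∪ {x | x ∈ t'} → t <:+ t' → V ≤ W := by
      intro V W t t' hV hW htt
      change V.1.1 ⊆ W.1.1
      rw [hV, hW]
      exact Set.union_subset_union_right _ fun x hx => htt.subset hx
    exact (List.suffix_or_suffix_of_suffix ht ht').imp (hle hV hW) (hle hW hV)
  · intro c hc hc_sub
    refine hc_sub.antisymm fun W hW => ?_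
    -- Letters of `p` are moved to `t`, last one first, as long as they lie in `W`. At the first `x
    -- ∉ W`, comparability with the member for `x :: t` forces `W` to be the member for `t`.
    have key : ∀ p t : List α, p ++ t = l.1 → U.1 ∪ {x | x ∈ t} ⊆ W.1.1 → W ∈ suffixChain U l.1 := by
      intro p
      induction p using List.reverseRecOn with
      | nil =>
        intro t ht hsub
        refine ⟨t, ht ▸ List.suffix_rfl, Set.Subset.antisymm (fun x _ => ?_) hsub⟩
        by_cases hx : x ∈ U.1
        · exact Or.inl hx
        · right
          have : t = l.1 := ht
          exact this ▸ (l.2.2.1 x).2 hx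
      | append_singleton p x ih =>
        intro t ht hsub
        have hs : x :: t <:+ l.1 := ⟨p, by simpa using ht⟩
        let V : Set.Icc U (⊤ : Upset α) :=
          ⟨⟨_, l.isUpperSet_union hs⟩, Set.subset_union_left, le_top⟩
        have hV : V ∈ c := hc_sub ⟨x :: t, hs, rfl⟩
        by_cases hx : x ∈ W.1.1
        · refine ih (x :: t) (by simpa using ht) (Set.union_subset W.2.1 fun y hy => ?_)
          rcases List.mem_cons.1 hy with rfl | hy
          · exact hx
          · exact hsub (Or.inr hy)
        · rcases hc.total hW hV with h | h
          · refine ⟨t, (List.suffix_cons x t).trans hs, Set.Subset.antisymm (fun y hy => ?_) hsub⟩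
            rcases h hy with hy' | hy'
            · exact Or.inl hy'
            · rcases List.mem_cons.1 hy' with rfl | hy'
              · exact absurd hy hx
              · exact Or.inr hy'
          · exact absurd (h (Or.inr List.mem_cons_self)) hx
    exact key l.1 [] (by simp) (by simpa using W.2.1)

theorem exists_partialExt [Fintype α] {U : Upset α} (s : Flag (Set.Icc U (⊤ : Upset α)))
    (V : Set.Icc U (⊤ : Upset α)) (hV : V ∈ s) :
    ∃ l : PartialExt V.1, ∀ t, t <:+ l.1 → ∃ W ∈ s, W.1.1 = V.1.1 ∪ {x | x ∈ t} := by
  induction h : (V.1.1ᶜ).ncard using Nat.strong_induction_on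
    generalizing V with
  | _ n ih =>
  subst h
  by_cases htop : ∀ x, x ∈ V.1.1
  · refine ⟨⟨[], by simp, by simp [htop], by simp⟩, fun t ht => ⟨V, hV, ?_⟩⟩
    simp [List.suffix_nil.1 ht]
  · push Not at htop
    obtain ⟨y, hy⟩ := htop
    have hUT : U ≤ (⊤ : Upset α) := le_top
    let T : Set.Icc U (⊤ : Upset α) := ⟨⊤, hUT, le_rfl⟩
    have hT : T ∈ s := Flag.mem_iff_forall_le_or_ge.2 fun b _ => Or.inr b.2.2
    obtain ⟨V', hV'⟩ := (Set.toFinite {W | W ∈ s ∧ V < W}).exists_minimal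
      ⟨T, hT, lt_of_le_of_ne V.2.2 fun h => hy (by
        have : V.1.1 = T.1.1 := by rw [h]
        rw [this]; trivial)⟩
    obtain ⟨hle, x₀, hx₀, hx₀'⟩ := Set.ssubset_iff_exists.1 (show V.1.1 ⊂ V'.1.1 from hV'.1.2)
    -- Maximality of `x` makes `V ∪ {x}` an upset. Lying between `V` and the next member `V'` of the
    -- flag, it is comparable to the whole flag and so belongs to it.
    obtain ⟨x, hx⟩ := (Set.toFinite (V'.1.1 \ V.1.1)).exists_maximal ⟨x₀, hx₀, hx₀'⟩
    have hup : IsUpperSet (V.1.1 ∪ {x}) := by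
      rintro a b hab (ha | rfl)
      · exact Or.inl (V.1.2 hab ha)
      · by_cases hb : b ∈ V.1.1
        · exact Or.inl hb
        · exact Or.inr (le_antisymm (hx.2 ⟨V'.1.2 hab hx.1.1, hb⟩ hab) hab)
    let W : Set.Icc U (⊤ : Upset α) :=
      ⟨⟨_, hup⟩, V.2.1.trans Set.subset_union_left, Set.subset_univ _⟩
    have hW : W ∈ s := by
      refine Flag.mem_iff_forall_le_or_ge.2 fun b hb => ?_
      have hbV : b ≤ V ∨ V' ≤ b := by
        rcases s.le_or_le hb hV with h | h
        · exact Or.inl h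
        · rcases eq_or_lt_of_le h with rfl | h
          · exact Or.inl le_rfl
          · rcases s.le_or_le hb hV'.1.1 with h' | h'
            · exact Or.inr (hV'.2 ⟨hb, h⟩ h')
            · exact Or.inr h'
      rcases hbV with h | h
      · exact Or.inr (h.trans Set.subset_union_left)
      · refine Or.inl (le_trans (b := V') (Set.union_subset hle ?_) h)
        simpa using hx.1.1
    have hlt : (W.1.1ᶜ).ncard < (V.1.1ᶜ).ncard := by
      refine Set.ncard_lt_ncard ⟨fun a ha ha' => ha (Or.inl ha'), fun h => ?_⟩ (Set.toFinite _)
      exact h (show x ∈ V.1.1ᶜ from hx.1.2) (Or.inr rfl)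
    obtain ⟨⟨l, hnd, hmem, hp⟩, hl⟩ := ih _ hlt W hW rfl
    have hxl : x ∉ l := by simp [hmem, W]
    refine ⟨⟨l ++ [x], ?_, fun a => ?_, ?_⟩, fun t ht => ?_⟩
    · exact hnd.append (by simp) (by simpa using hxl)
    · have hxV : x ∉ V.1.1 := hx.1.2
      by_cases hax : a = x
      · simp [hax, hxV]
      · simp [hmem, W, hax]
    · refine List.pairwise_append.2 ⟨hp, by simp, fun a ha b hb hba => ?_⟩
      rw [List.mem_singleton] at hb
      subst hb
      exact (hmem a).1 ha (W.1.2 hba.le (Or.inr rfl))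
    · rcases List.suffix_concat_iff.1 ht with rfl | ⟨t', rfl, ht'⟩
      · exact ⟨V, hV, by simp⟩
      · obtain ⟨Y, hY, hYt⟩ := hl t' ht'
        refine ⟨Y, hY, hYt.trans ?_⟩
        ext a
        simp only [W, Set.mem_union, Set.mem_ofPred_eq, List.mem_append, List.mem_singleton,
          Set.mem_singleton_iff]
        tauto

theorem card_flag_eq [Fintype α] (U : Upset α) :
    Nat.card (Flag (Set.Icc U (⊤ : Upset α))) = Nat.card (PartialExt U) := by
  symm
  refine Nat.card_eq_of_bijective
    (fun l => Flag.ofIsMaxChain (suffixChain U l.1) (isMaxChain_suffixChain l)) ⟨?_, ?_⟩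
  · intro l l' h
    have hc : suffixChain U l.1 = suffixChain U l'.1 := congrArg Flag.carrier h
    have key : ∀ l l' : PartialExt U, suffixChain U l.1 = suffixChain U l'.1 → l.1 <:+ l'.1 := by
      intro l l' hc
      refine suffix_of_suffix_mem l.2.1 l'.2.1 fun t ht => ?_
      have h1 : (⟨⟨_, l.isUpperSet_union ht⟩, Set.subset_union_left, Set.subset_univ _⟩ :
          Set.Icc U (⊤ : Upset α)) ∈ suffixChain U l'.1 := hc ▸ ⟨t, ht, rfl⟩
      obtain ⟨t', ht', h2⟩ := h1
      refine ⟨t', ht', fun x => ?_⟩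
      have h3 := congrArg (x ∈ ·) h2
      simp only [Set.mem_union, Set.mem_ofPred_eq, eq_iff_iff] at h3
      have h4 : x ∈ t → x ∉ U.1 := fun hx => (l.2.2.1 x).1 (ht.subset hx)
      have h5 : x ∈ t' → x ∉ U.1 := fun hx => (l'.2.2.1 x).1 (ht'.subset hx)
      tauto
    have h1 := key l l' hc
    exact Subtype.ext (h1.eq_of_length_le (key l' l hc.symm).length_le)
  · intro s
    have hUT : U ≤ (⊤ : Upset α) := le_top
    obtain ⟨l, hl⟩ := exists_partialExt s ⟨U, le_rfl, hUT⟩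
      (Flag.mem_iff_forall_le_or_ge.2 fun b _ => Or.inl b.2.1)
    refine ⟨l, Flag.ext ?_⟩
    refine (isMaxChain_suffixChain l).2 s.chain_le ?_
    rintro W ⟨t, ht, hW⟩
    obtain ⟨W', hW', h⟩ := hl t ht
    have : W = W' := Subtype.ext (Subtype.ext (hW.trans h.symm))
    exact this ▸ hW'

end Flags

/-! ### Sums of derangement numbers -/

/-- After exchanging sums, the inner sum of `μ(x, y)` over `x ∈ [a, y]` vanishes unless `y = a`. -/
theorem sum_derangementNumber {Λ : Type*} [PartialOrder Λ] [OrderTop Λ] [Fintype Λ]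
    [LocallyFiniteOrder Λ] (a : Λ) :
    ∑ x : Λ with a ≤ x, derangementNumber x = (Nat.card (Flag (Set.Icc a (⊤ : Λ))) : ℤ) := by
  have h1 : ∀ x y : Λ, x ∈ Finset.univ.filter (fun x => a ≤ x) ∧
      y ∈ Finset.univ.filter (fun y => x ≤ y) ↔
      x ∈ Finset.Icc a y ∧ y ∈ (Finset.univ : Finset Λ) := by
    intro x y
    simp
  simp only [derangementNumber]
  rw [Finset.sum_comm' h1]
  simp only [← Finset.sum_mul, IncidenceAlgebra.sum_Icc_mu_left]
  simp

/-! ### Fixed points of promotions as sums of derangement numbers -/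

section Promotion

variable {α : Type*} [PartialOrder α]

theorem promoteSet_empty (π : LinExt α) : promoteSet ∅ π = π := by
  simp [promoteSet]

theorem promoteSet_singleton (a : α) (π : LinExt α) : promoteSet {a} π = promote a π := by
  have h : ∃ b, ({a} : Finset α) = {b} := ⟨a, rfl⟩
  rw [promoteSet, dif_pos h, ← Finset.singleton_injective h.choose_spec]

variable [Fintype α]

theorem fixCount_promote_eq_sum (hα : IsRootedForest α) (w : List α) :
    (fixCount promote w : ℤ) = ∑ S : Upset α with ∀ a ∈ w, a ∈ S.1, derangementNumber S := by
  rw [fixCount_promote hα, ← card_flag_eq, ← sum_derangementNumber]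
  refine Finset.sum_congr (Finset.filter_congr fun S _ => ?_) fun _ _ => rfl
  constructor
  · exact fun h a ha => h ⟨a, ha, le_rfl⟩
  · rintro h x ⟨a, ha, hax⟩
    exact S.2 hax (h a ha)

theorem derangementNumber_nonneg (hα : IsRootedForest α) (S : Upset α) :
    0 ≤ derangementNumber S :=
  nonneg_of_fixCount promote derangementNumber (fun S a => a ∈ S.1)
    (fun _ _ h => Subtype.ext (Set.ext fun a => iff_of_eq (congrFun h a)))
    (fixCount_promote_eq_sum hα) S

theorem fixCount_promoteSet (hα : IsRootedForest α) (w : List (Finset α))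
    (hw : ∀ s ∈ w, s.card ≤ 1) :
    (fixCount promoteSet w : ℤ) =
      ∑ S : Upset α with ∀ s ∈ w, ∀ a ∈ s, a ∈ S.1, derangementNumber S := by
  obtain ⟨v, hv, hmem⟩ : ∃ v : List α, (∀ π, wordMap promoteSet w π = wordMap promote v π) ∧
      ∀ a, a ∈ v ↔ ∃ s ∈ w, a ∈ s := by
    induction w with
    | nil => exact ⟨[], fun _ => rfl, by simp⟩
    | cons s w ih =>
      obtain ⟨v, hv, hmem⟩ := ih fun t ht => hw t (by simp [ht])
      obtain rfl | ⟨a, rfl⟩ : s = ∅ ∨ ∃ a, s = {a} := by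
        have h1 := hw s (by simp)
        rcases Nat.le_one_iff_eq_zero_or_eq_one.1 h1 with h | h
        · exact Or.inl (Finset.card_eq_zero.1 h)
        · exact Or.inr (Finset.card_eq_one.1 h)
      · exact ⟨v, fun π => by rw [wordMap_cons, promoteSet_empty, hv], by simp [hmem]⟩
      · exact ⟨a :: v, fun π => by rw [wordMap_cons, promoteSet_singleton, hv, wordMap_cons],
          by simp [hmem]⟩
  have h1 : fixCount promoteSet w = fixCount promote v := by
    simp only [fixCount_eq_card, hv]
  rw [h1, fixCount_promote_eq_sum hα]
  refine Finset.sum_congr (Finset.filter_congr fun S _ => ?_) fun _ _ => rfl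
  simp only [hmem]
  grind

end Promotion

/-! ### Permutations with a given orbit partition -/

section Orbits

open Equiv.Perm

variable {α : Type*} [Fintype α]

theorem card_transitive_perm [Nonempty α] :
    Nat.card {σ : Equiv.Perm α // ∀ x y, σ.SameCycle x y} = (Fintype.card α - 1).factorial := by
  -- On at most one point the only permutation is the identity, which is transitive without being a
  -- cycle; otherwise transitive means having the single cycle length `Fintype.card α`.
  by_cases h1 : Fintype.card α ≤ 1
  · have : Subsingleton α := Fintype.card_le_one_iff_subsingleton.1 h1
    have h2 : Fintype.card α - 1 = 0 := by omega
    rw [h2, Nat.factorial_zero, Nat.card_eq_one_iff_unique]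
    exact ⟨inferInstance, ⟨⟨1, fun x y => ⟨0, Subsingleton.elim _ _⟩⟩⟩⟩
  · have h2 := card_of_cycleType_singleton (α := α) (n := Fintype.card α) (by omega) le_rfl
    rw [Nat.choose_self, mul_one] at h2
    rw [← h2, Nat.card_eq_fintype_card, Fintype.card_subtype]
    congr 1
    ext σ
    simp only [Finset.mem_filter, Finset.mem_univ, true_and]
    constructor
    · intro h
      have hne : ∀ x, σ x ≠ x := by
        intro x hx
        obtain ⟨y, hy⟩ := Fintype.exists_ne_of_one_lt_card (by omega) x
        obtain ⟨k, hk⟩ := h x y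
        exact hy (by rw [← hk, zpow_apply_eq_self_of_apply_eq_self hx])
      have hc : σ.IsCycle := by
        obtain ⟨x⟩ := ‹Nonempty α›
        exact ⟨x, hne x, fun y _ => h x y⟩
      rw [hc.cycleType]
      have : σ.support = Finset.univ := by ext x; simp [hne]
      rw [this, Finset.card_univ]
    · intro h x y
      have hc : σ.IsCycle := card_cycleType_eq_one.1 (by rw [h]; simp)
      have hs : σ.support = Finset.univ := by
        rw [← Finset.card_eq_iff_eq_univ, ← sum_cycleType, h]
        simp
      have hne : ∀ x, σ x ≠ x := fun x => mem_support.1 (hs ▸ Finset.mem_univ x)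
      exact hc.sameCycle (hne x) (hne y)

/-- The partition of `α` into the orbits of a permutation. -/
def orbitPartition (σ : Equiv.Perm α) : Finpartition (Finset.univ : Finset α) :=
  Finpartition.ofSetoid (SameCycle.setoid σ)

theorem mem_part_orbitPartition (σ : Equiv.Perm α) (x y : α) :
    y ∈ (orbitPartition σ).part x ↔ σ.SameCycle x y :=
  Finpartition.mem_part_ofSetoid_iff_rel

theorem finpartition_eq_iff {β γ : Finpartition (Finset.univ : Finset α)} :
    β = γ ↔ ∀ x y, y ∈ β.part x ↔ y ∈ γ.part x := by
  refine ⟨fun h => by simp [h], fun h => ?_⟩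
  have h1 : ∀ x, β.part x = γ.part x := fun x => Finset.ext (h x)
  have key : ∀ β γ : Finpartition (Finset.univ : Finset α), (∀ x, β.part x = γ.part x) →
      ∀ B ∈ β.parts, B ∈ γ.parts := by
    intro β γ h B hB
    obtain ⟨x, hx⟩ := β.nonempty_of_mem_parts hB
    rw [← β.part_eq_of_mem hB hx, h]
    simp
  ext B
  exact ⟨key β γ h1 B, key γ β (fun x => (h1 x).symm) B⟩

/-- Restriction to the blocks is a bijection onto the families of transitive permutations of the
blocks. -/
theorem card_orbitPartition_eq (β : Finpartition (Finset.univ : Finset α)) :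
    Nat.card {σ : Equiv.Perm α // orbitPartition σ = β} =
      ∏ B ∈ β.parts, (B.card - 1).factorial := by
  have h1 : ∏ B ∈ β.parts, (B.card - 1).factorial =
      Nat.card (∀ B : β.parts, {τ : Equiv.Perm {x // x ∈ B.1} // ∀ x y, τ.SameCycle x y}) := by
    rw [Nat.card_pi, ← Finset.prod_coe_sort]
    refine Finset.prod_congr rfl fun B _ => ?_
    have : Nonempty {x // x ∈ B.1} := (β.nonempty_of_mem_parts B.2).to_subtype
    rw [card_transitive_perm]
    simp
  rw [h1]
  have hmem : ∀ σ : Equiv.Perm α, orbitPartition σ = β → ∀ B ∈ β.parts, ∀ x,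
      σ x ∈ B ↔ x ∈ B := by
    rintro σ rfl B hB x
    rw [← Finpartition.part_eq_iff_mem _ hB, ← Finpartition.part_eq_iff_mem _ hB]
    have h2 : (orbitPartition σ).part (σ x) = (orbitPartition σ).part x := by
      ext y
      simp [mem_part_orbitPartition]
    rw [h2]
  refine Nat.card_eq_of_bijective (fun σ B => ⟨σ.1.subtypePerm (hmem σ.1 σ.2 B.1 B.2), fun x y => ?_⟩)
    ⟨fun σ σ' h => ?_, fun τ => ?_⟩
  · rw [sameCycle_subtypePerm, ← mem_part_orbitPartition, σ.2, β.part_eq_of_mem B.2 x.2]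
    exact y.2
  · refine Subtype.ext (Equiv.ext fun x => ?_)
    have hx : x ∈ β.part x := β.mem_part (Finset.mem_univ x)
    have h2 := congrFun h ⟨β.part x, β.part_mem.2 (Finset.mem_univ x)⟩
    have h3 := Equiv.congr_fun (Subtype.mk.inj h2) ⟨x, hx⟩
    simpa using h3
  · let e : α ≃ Σ B : β.parts, B.1 :=
      (Equiv.subtypeUnivEquiv (p := fun x => x ∈ Finset.univ) Finset.mem_univ).symm.trans β.equivSigmaParts
    let σ : Equiv.Perm α := e.symm.permCongr (Equiv.Perm.sigmaCongrRight fun B => (τ B).1)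
    have hσ : ∀ (B : β.parts) (x : {x // x ∈ B.1}), σ x = ((τ B).1 x).1 := by
      intro B x
      have h2 : e x.1 = ⟨B, x⟩ := by
        rw [← Equiv.eq_symm_apply]
        rfl
      simp only [σ, Equiv.permCongr_apply, Equiv.symm_symm, h2]
      rfl
    have hB : ∀ (B : β.parts) (x : α), σ x ∈ B.1 ↔ x ∈ B.1 := by
      have h2 : ∀ (B : β.parts) (x : α), x ∈ B.1 → σ x ∈ B.1 := by
        intro B x hx
        rw [hσ B ⟨x, hx⟩]
        exact Subtype.prop _
      refine fun B x => ⟨fun hx => ?_, h2 B x⟩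
      have hx' := h2 ⟨β.part x, β.part_mem.2 (Finset.mem_univ x)⟩ x (β.mem_part (Finset.mem_univ x))
      rw [← β.part_eq_of_mem B.2 hx, β.part_eq_of_mem (β.part_mem.2 (Finset.mem_univ x)) hx']
      exact β.mem_part (Finset.mem_univ x)
    have hpow : ∀ (B : β.parts) (k : ℤ) (x : {x // x ∈ B.1}), (σ ^ k) x = (((τ B).1 ^ k) x).1 := by
      intro B k x
      have h3 : (τ B).1 = σ.subtypePerm (hB B) := Equiv.ext fun x => Subtype.ext (hσ B x).symm
      rw [h3]
      simp
    have horb : orbitPartition σ = β := by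
      rw [finpartition_eq_iff]
      intro x y
      rw [mem_part_orbitPartition]
      have hx : x ∈ β.part x := β.mem_part (Finset.mem_univ x)
      let B : β.parts := ⟨β.part x, β.part_mem.2 (Finset.mem_univ x)⟩
      constructor
      · rintro ⟨k, rfl⟩
        rw [hpow B k ⟨x, hx⟩]
        exact Subtype.prop _
      · intro hy
        obtain ⟨k, hk⟩ := (τ B).2 ⟨x, hx⟩ ⟨y, hy⟩
        exact ⟨k, by rw [hpow B k ⟨x, hx⟩, hk]⟩
    refine ⟨⟨σ, horb⟩, ?_⟩
    funext B
    refine Subtype.ext (Equiv.ext fun x => Subtype.ext ?_)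
    exact hσ B x

/-- A permutation preserves `key` exactly when `key` is constant on its orbits, so the permutations
can be counted by orbit partition. -/
theorem card_perm_preserving {κ : Type*} (key : α → κ) :
    Nat.card {σ : Equiv.Perm α // ∀ x, key (σ x) = key x} =
      ∑ β : Finpartition (Finset.univ : Finset α) with
        ∀ B ∈ β.parts, ∀ x ∈ B, ∀ y ∈ B, key x = key y,
        ∏ B ∈ β.parts, (B.card - 1).factorial := by
  simp only [← card_orbitPartition_eq]
  rw [Nat.card_eq_fintype_card, Fintype.card_subtype, Finset.card_eq_sum_card_fiberwise
    (f := orbitPartition) (t := Finset.univ.filter fun β : Finpartition (Finset.univ : Finset α) =>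
        ∀ B ∈ β.parts, ∀ x ∈ B, ∀ y ∈ B, key x = key y)]
  · refine Finset.sum_congr rfl fun β hβ => ?_
    rw [Nat.card_eq_fintype_card, Fintype.card_subtype, Finset.filter_filter]
    congr 1
    refine Finset.filter_congr fun σ _ => ⟨fun h => h.2, fun h => ⟨fun x => ?_, h⟩⟩
    subst h
    have hβ := (Finset.mem_filter.1 hβ).2
    refine hβ ((orbitPartition σ).part x) (by simp) _ ?_ _ (by simp)
    rw [mem_part_orbitPartition]
    exact ⟨1, by simp⟩
  · intro σ hσ
    have hσ := (Finset.mem_filter.1 hσ).2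
    refine Finset.mem_filter.2 ⟨Finset.mem_univ _, fun B hB x hx y hy => ?_⟩
    rw [← (orbitPartition σ).part_eq_of_mem hB hx, mem_part_orbitPartition] at hy
    obtain ⟨k, rfl⟩ := hy
    have hk : ∀ k : ℤ, key ((σ ^ k) x) = key x := by
      intro k
      induction k using Int.induction_on with
      | zero => simp
      | succ k ih => rw [add_comm, zpow_one_add, mul_apply, hσ, ih]
      | pred k ih => rw [← hσ, ← mul_apply, ← zpow_one_add, add_sub_cancel, ih]
    exact (hk k).symm

end Orbits

/-! ### Fixed points of words of pop shuffles -/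

section PopShuffle

variable {α : Type*}

/-- The number whose binary digits record in which sets of the word `x` lies. -/
def bitKey : List (Finset α) → α → ℕ
  | [], _ => 0
  | s :: w, x => (if x ∈ s then 1 else 0) + 2 * bitKey w x

theorem bitKey_eq_iff (w : List (Finset α)) (x y : α) :
    bitKey w x = bitKey w y ↔ ∀ s ∈ w, x ∈ s ↔ y ∈ s := by
  induction w with
  | nil => simp [bitKey]
  | cons s w ih =>
    rw [List.forall_mem_cons, ← ih, bitKey, bitKey]
    by_cases hx : x ∈ s <;> by_cases hy : y ∈ s <;>
      simp only [hx, hy, if_true, if_false, true_and, iff_true, iff_false, not_true, false_and] <;> omega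

theorem before_moveToBack (s : Finset α) (π : TotalOrdering α) (x y : α) :
    Before (moveToBack s π).1 x y ↔
      ((x ∈ s ↔ y ∈ s) ∧ Before π.1 x y) ∨ (x ∉ s ∧ y ∈ s) := by
  rw [moveToBack, before_append, before_filter, before_filter]
  simp only [List.mem_filter, π.2.2, true_and, decide_eq_true_eq]
  tauto

/-- This is a stable radix sort: the first set of the word is the least significant digit, and later
sets override it. -/
theorem before_wordMap_moveToBack (w : List (Finset α)) (π : TotalOrdering α) (x y : α) :
    Before (wordMap moveToBack w π).1 x y ↔
      (bitKey w x = bitKey w y ∧ Before π.1 x y) ∨ bitKey w x < bitKey w y := by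
  induction w generalizing π with
  | nil => simp [bitKey]
  | cons s w ih =>
    rw [wordMap_cons, ih, before_moveToBack, bitKey, bitKey]
    by_cases hb : Before π.1 x y <;> by_cases hx : x ∈ s <;> by_cases hy : y ∈ s <;>
      simp only [hb, hx, hy, if_true, if_false, and_true, iff_true, iff_false, not_true,
        and_false, not_false_eq_true, or_false, false_or] <;> omega

theorem wordMap_moveToBack_eq_self_iff (w : List (Finset α)) (π : TotalOrdering α) :
    wordMap moveToBack w π = π ↔ π.1.Pairwise fun x y => bitKey w x ≤ bitKey w y := by
  rw [pairwise_iff_before]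
  constructor
  · intro h x y hxy
    by_contra hlt
    have := (before_wordMap_moveToBack w π y x).2 (Or.inr (not_le.1 hlt))
    rw [h] at this
    exact this.asymm π.2.1 hxy
  · refine fun h => TotalOrdering.ext_before fun x y => ?_
    rw [before_wordMap_moveToBack]
    constructor
    · rintro (h' | h')
      · exact h'.2
      · have hne : x ≠ y := by rintro rfl; exact h'.false
        exact (before_or_before (π.2.2 x) (π.2.2 y) hne).resolve_right
          fun h'' => h'.not_ge (h _ _ h'')
    · intro h'
      have := h _ _ h'
      rcases this.eq_or_lt with h1 | h1
      · exact Or.inl ⟨h1, h'⟩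
      · exact Or.inr h1

/-- Relabelling one fixed sorted ordering `π₀` by `σ` reaches every ordering once. The result is
sorted exactly when `σ` preserves `key`, because two sorted orderings have the same sequence of
keys. -/
theorem card_sorted_totalOrdering [Fintype α] (key : α → ℕ) :
    Nat.card {π : TotalOrdering α // π.1.Pairwise fun x y => key x ≤ key y} =
      Nat.card {σ : Equiv.Perm α // ∀ x, key (σ x) = key x} := by
  obtain ⟨π₀, h₀⟩ : ∃ π : TotalOrdering α, π.1.Pairwise fun x y => key x ≤ key y := by
    have hp := List.mergeSort_perm (Finset.univ : Finset α).toList fun x y => decide (key x ≤ key y)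
    refine ⟨⟨(Finset.univ : Finset α).toList.mergeSort fun x y => decide (key x ≤ key y),
      hp.nodup_iff.2 (Finset.nodup_toList _), fun a => hp.mem_iff.2 (by simp)⟩, ?_⟩
    have := List.pairwise_mergeSort (le := fun x y => decide (key x ≤ key y))
      (fun a b c h1 h2 => by simp at h1 h2 ⊢; omega) (fun a b => by simp; omega)
      (Finset.univ : Finset α).toList
    simpa using this
  symm
  refine Nat.card_eq_of_bijective (fun σ => ⟨⟨π₀.1.map σ.1, π₀.2.1.map σ.1.injective, fun a => ?_⟩, ?_⟩)
    ⟨fun σ σ' h => ?_, fun π => ?_⟩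
  · rw [List.mem_map]
    exact ⟨σ.1.symm a, π₀.2.2 _, by simp⟩
  · rw [List.pairwise_map]
    exact h₀.imp fun h => by rwa [σ.2, σ.2]
  · refine Subtype.ext (Equiv.ext fun x => ?_)
    exact List.map_inj_left.1 (Subtype.mk.inj (Subtype.mk.inj h)) x (π₀.2.2 x)
  · obtain ⟨⟨l, hnd, hmem⟩, hl⟩ := π
    have hp : l.Perm π₀.1 := (List.perm_ext_iff_of_nodup hnd π₀.2.1).2 fun a => by simp [hmem, π₀.2.2]
    let σ : Equiv.Perm α := (π₀.2.1.getEquivOfForallMemList _ π₀.2.2).symm.trans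
      ((finCongr hp.length_eq.symm).trans (hnd.getEquivOfForallMemList _ hmem))
    have hσ : π₀.1.map σ = l := by
      refine List.ext_getElem (by simp [hp.length_eq]) fun i h1 h2 => ?_
      rw [List.getElem_map]
      have h3 : (π₀.2.1.getEquivOfForallMemList _ π₀.2.2).symm (π₀.1[i]'(by simpa using h1)) =
          ⟨i, by simpa using h1⟩ := by
        rw [Equiv.symm_apply_eq]
        rfl
      simp [σ, h3]
    refine ⟨⟨σ, ?_⟩, Subtype.ext (Subtype.ext hσ)⟩
    have h1 : (π₀.1.map σ).map key = π₀.1.map key := by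
      rw [hσ]
      refine (hp.map key).eq_of_pairwise (le := (· ≤ ·)) (fun a b _ _ h h' => le_antisymm h h') ?_ ?_
      · rwa [List.pairwise_map]
      · rwa [List.pairwise_map]
    rw [List.map_map] at h1
    intro x
    exact List.map_inj_left.1 h1 x (π₀.2.2 x)

theorem fixCount_moveToBack [Fintype α] (w : List (Finset α)) :
    fixCount moveToBack w = ∑ β : Finpartition (Finset.univ : Finset α) with
      ∀ s ∈ w, ∀ B ∈ β.parts, ∀ x ∈ B, ∀ y ∈ B, x ∈ s ↔ y ∈ s,
      ∏ B ∈ β.parts, (B.card - 1).factorial := by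
  rw [fixCount_eq_card]
  simp only [wordMap_moveToBack_eq_self_iff]
  rw [card_sorted_totalOrdering (bitKey w), card_perm_preserving (bitKey w)]
  simp only [bitKey_eq_iff]
  refine congrArg (fun t : Finset (Finpartition (Finset.univ : Finset α)) =>
    ∑ β ∈ t, ∏ B ∈ β.parts, (B.card - 1).factorial) ?_
  ext β
  simp only [Finset.mem_filter, Finset.mem_univ, true_and]
  exact ⟨fun h s hs B hB x hx y hy => h B hB x hx y hy s hs,
    fun h B hB x hx y hy s hs => h s hs B hB x hx y hy⟩

end PopShuffle

/-! ### The tree -/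

section Tree

variable {T : RootedTree} {d : ℕ}

theorem exists_bottom_covBy (hd : 1 ≤ d) {e : T} (he : Order.height e = (d : ℕ∞)) :
    ∃ v : T, Order.height v + 1 = (d : ℕ∞) ∧ v ⋖ e := by
  have hmin : ¬ IsMin e := fun h => by
    rw [Order.height_eq_zero.2 h] at he
    have : d = 0 := by exact_mod_cast he.symm
    omega
  have hcov := Order.pred_covBy_of_not_isMin hmin
  -- Everything strictly below `e` lies below its parent `Order.pred e`, so the parent alone
  -- determines the height of `e`.
  refine ⟨Order.pred e, le_antisymm (he ▸ Order.height_add_one_le hcov.lt) ?_, hcov⟩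
  rw [← he, Order.height_eq_iSup_lt_height]
  exact iSup₂_le fun y hy => add_le_add_left (Order.height_mono (Order.le_pred_of_lt hy)) 1

variable [Fintype T]

/-- A leaf strictly below `c` in the tree would have depth at least `d + 1`. -/
theorem isMax_of_bottom_covBy (hdepth : ∀ v : T, IsMax v → Order.height v = (d : ℕ∞))
    {v c : T} (hv : Order.height v + 1 = (d : ℕ∞)) (hc : v ⋖ c) : IsMax c := by
  obtain ⟨m, hcm, hm⟩ := (Set.toFinite (Set.Ici c)).exists_le_maximal (le_refl c)
  have hmax : IsMax m := fun b hb => hm.2 (le_trans hcm hb) hb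
  rcases eq_or_lt_of_le hcm with rfl | hlt
  · exact hmax
  · have h1 := Order.height_add_one_le hc.lt
    have h2 := Order.height_add_one_le hlt
    rw [hdepth m hmax] at h2
    rw [hv] at h1
    have h3 : ((d + 1 : ℕ) : ℕ∞) ≤ (d : ℕ∞) := by
      push_cast
      exact (add_le_add_left h1 1).trans h2
    exact absurd (ENat.natCast_le_natCast.1 h3) (by omega)

theorem mem_relatedChildren_bottom (hdepth : ∀ v : T, IsMax v → Order.height v = (d : ℕ∞))
    (E : Finset (Leaf T)) (v : Bottom T d) (c : Child v.1) :
    c ∈ relatedChildren E v.1 ↔ ∃ e ∈ E, c.node = e.1 := by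
  simp only [relatedChildren, Finset.mem_filter, Finset.mem_univ, true_and]
  refine exists_congr fun e => and_congr_right fun _ => ⟨fun h => ?_, fun h => h.le⟩
  exact le_antisymm h (isMax_of_bottom_covBy hdepth v.2 c.2 h)

theorem card_relatedChildren_le_one (hdepth : ∀ v : T, IsMax v → Order.height v = (d : ℕ∞))
    {E : Finset (Leaf T)} (hE : E ∈ admissible T) (v : Bottom T d) :
    (relatedChildren E v.1).card ≤ 1 := by
  refine Finset.card_le_one.2 fun a ha b hb => ?_
  obtain ⟨e, he, hae⟩ := (mem_relatedChildren_bottom hdepth E v a).1 ha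
  obtain ⟨e', he', hbe⟩ := (mem_relatedChildren_bottom hdepth E v b).1 hb
  have h := (Finset.mem_filter.1 hE).2 e he e' he' ⟨v.1, hae ▸ a.2, hbe ▸ b.2⟩
  exact Subtype.ext (hae.trans ((congrArg Subtype.val h).trans hbe.symm))

theorem isCompatible_iff (α : TreePartition T d) (E : Finset (Leaf T)) :
    IsCompatible α E ↔ ∀ v : Upper T d, ∀ B ∈ (α v).parts, ∀ x ∈ B, ∀ y ∈ B,
      x ∈ relatedChildren E v.1 ↔ y ∈ relatedChildren E v.1 := by
  refine forall_congr' fun v => ?_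
  constructor
  · intro h B hB x hx y hy
    obtain ⟨C, hC, hBC⟩ := h hB
    have hC' := Finset.mem_of_mem_erase hC
    rw [Finset.mem_insert, Finset.mem_singleton] at hC'
    rcases hC' with rfl | rfl
    · have h1 := Finset.mem_compl.1 (hBC hx)
      have h2 := Finset.mem_compl.1 (hBC hy)
      tauto
    · have h1 := hBC hx
      have h2 := hBC hy
      tauto
  · intro h B hB
    obtain ⟨x, hx⟩ := (α v).nonempty_of_mem_parts hB
    by_cases hxE : x ∈ relatedChildren E v.1
    · refine ⟨relatedChildren E v.1, Finset.mem_erase.2 ⟨?_, by simp⟩,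
        fun y hy => (h B hB x hx y hy).1 hxE⟩
      exact Finset.ne_empty_of_mem hxE
    · refine ⟨(relatedChildren E v.1)ᶜ, Finset.mem_erase.2 ⟨?_, by simp⟩,
        fun y hy => Finset.mem_compl.2 fun hy' => hxE ((h B hB x hx y hy).2 hy')⟩
      exact Finset.ne_empty_of_mem (Finset.mem_compl.2 hxE)

variable [P : ∀ v : Bottom T d, PartialOrder (Child v.1)]

theorem isContained_iff (hd : 1 ≤ d) (hdepth : ∀ v : T, IsMax v → Order.height v = (d : ℕ∞))
    (E : Finset (Leaf T)) (S : Upset (LeafPoset T d)) :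
    IsContained E S ↔
      ∀ v : Bottom T d, ∀ a ∈ relatedChildren E v.1, a ∈ (Upset.part S v).1 := by
  simp only [mem_relatedChildren_bottom hdepth]
  constructor
  · rintro h v a ⟨e, he, hae⟩
    obtain ⟨⟨v', c⟩, hp, hc⟩ := h e he
    have h1 : v = v' := by
      refine Subtype.ext ?_
      have h2 : v'.1 ⋖ e.1 := hc ▸ c.2
      have h3 : v.1 ⋖ e.1 := hae ▸ a.2
      -- A node has only one parent, so both leaf posets containing `e` coincide.
      rw [← h2.pred_eq, ← h3.pred_eq]
    subst h1
    have h2 : a = c := Subtype.ext (hae.trans hc.symm)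
    exact h2 ▸ hp
  · intro h e he
    obtain ⟨v, hv, hve⟩ := exists_bottom_covBy hd (hdepth e.1 e.2)
    exact ⟨⟨⟨v, hv⟩, ⟨e.1, hve⟩⟩, h ⟨v, hv⟩ ⟨e.1, hve⟩ ⟨e, he, rfl⟩, rfl⟩

/-- An upset of the disjoint union of the leaf posets is a family of upsets. -/
def upsetEquiv : Upset (LeafPoset T d) ≃ ∀ v : Bottom T d, Upset (Child v.1) where
  toFun S v := Upset.part S v
  invFun U := ⟨{p | p.2 ∈ (U p.1).1}, by
    rintro _ _ ⟨v, a, b, hab⟩ ha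
    exact (U v).2 hab ha⟩
  left_inv S := rfl
  right_inv U := rfl

/-! ### Fixed points of words on the whole tree -/

theorem wordMap_move (w : List (Finset (Leaf T))) (π : TreeOrdering P) :
    wordMap move w π =
      (fun v => wordMap promoteSet (w.map fun E => relatedChildren E v.1) (π.1 v),
        fun v => wordMap moveToBack (w.map fun E => relatedChildren E v.1) (π.2 v)) := by
  induction w generalizing π with
  | nil => rfl
  | cons E w ih => rw [wordMap_cons, ih]; rfl

theorem fixCount_move (w : List (Finset (Leaf T))) :
    fixCount (move (P := P)) w =
      (∏ v : Bottom T d, fixCount promoteSet (w.map fun E => relatedChildren E v.1)) *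
        ∏ v : Upper T d, fixCount moveToBack (w.map fun E => relatedChildren E v.1) := by
  simp only [fixCount_eq_card]
  rw [← Nat.card_pi, ← Nat.card_pi, ← Nat.card_prod]
  simp only [wordMap_move]
  exact Nat.card_congr
    { toFun := fun π => (fun v => ⟨π.1.1 v, congrFun (congrArg Prod.fst π.2) v⟩,
        fun v => ⟨π.1.2 v, congrFun (congrArg Prod.snd π.2) v⟩)
      invFun := fun ρ => ⟨(fun v => (ρ.1 v).1, fun v => (ρ.2 v).1),
        Prod.ext (funext fun v => (ρ.1 v).2) (funext fun v => (ρ.2 v).2)⟩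
      left_inv := fun _ => rfl
      right_inv := fun _ => rfl }

theorem fixCount_move_eq_sum (hd : 1 ≤ d)
    (hdepth : ∀ v : T, IsMax v → Order.height v = (d : ℕ∞))
    (hforest : ∀ v : Bottom T d, IsRootedForest (Child v.1))
    (w : List (Finset (Leaf T))) (hw : ∀ E ∈ w, E ∈ admissible T) :
    (fixCount (move (P := P)) w : ℤ) =
      ∑ j : Upset (LeafPoset T d) × TreePartition T d with
        ∀ E ∈ w, IsContained E j.1 ∧ IsCompatible j.2 E, mult j.1 j.2 := by
  have h1 : (∏ v : Bottom T d,
      (fixCount promoteSet (w.map fun E => relatedChildren E v.1) : ℤ)) =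
      ∑ S : Upset (LeafPoset T d), if ∀ E ∈ w, IsContained E S then
        ∏ v : Bottom T d, derangementNumber (Upset.part S v) else 0 := by
    have h2 : ∀ v : Bottom T d,
        (fixCount promoteSet (w.map fun E => relatedChildren E v.1) : ℤ) =
        ∑ U : Upset (Child v.1), if ∀ E ∈ w, ∀ a ∈ relatedChildren E v.1, a ∈ U.1 then
          derangementNumber U else 0 := by
      intro v
      rw [fixCount_promoteSet (hforest v), Finset.sum_filter]
      · simp
      · simp only [List.mem_map]
        rintro _ ⟨E, hE, rfl⟩
        exact card_relatedChildren_le_one hdepth (hw E hE) v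
    simp only [h2]
    -- Expanding the product of sums chooses one upset per leaf poset, which is one upset of their
    -- disjoint union.
    rw [Finset.prod_univ_sum, Fintype.piFinset_univ, ← upsetEquiv.sum_comp]
    refine Finset.sum_congr rfl fun S _ => ?_
    rw [Finset.prod_ite_zero]
    simp only [isContained_iff hd hdepth, upsetEquiv, Finset.mem_univ, true_imp_iff]
    congr 1
    exact propext ⟨fun h E hE v => h v E hE, fun h v E hE => h E hE v⟩
  have h2 : (∏ v : Upper T d,
      (fixCount moveToBack (w.map fun E => relatedChildren E v.1) : ℤ)) =
      ∑ α : TreePartition T d, if ∀ E ∈ w, IsCompatible α E then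
        ∏ v : Upper T d, ∏ B ∈ (α v).parts, ((B.card - 1).factorial : ℤ) else 0 := by
    have h3 : ∀ v : Upper T d,
        (fixCount moveToBack (w.map fun E => relatedChildren E v.1) : ℤ) =
        ∑ β : Finpartition (Finset.univ : Finset (Child v.1)),
          if ∀ E ∈ w, ∀ B ∈ β.parts, ∀ x ∈ B, ∀ y ∈ B,
            x ∈ relatedChildren E v.1 ↔ y ∈ relatedChildren E v.1 then
          ∏ B ∈ β.parts, ((B.card - 1).factorial : ℤ) else 0 := by
      intro v
      rw [fixCount_moveToBack, Finset.sum_filter]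
      simp
    simp only [h3]
    rw [Finset.prod_univ_sum, Fintype.piFinset_univ]
    refine Finset.sum_congr rfl fun α _ => ?_
    by_cases h : ∀ E ∈ w, IsCompatible α E
    · rw [if_pos h]
      exact Finset.prod_congr rfl fun v _ =>
        if_pos fun E hE => (isCompatible_iff α E).1 (h E hE) v
    · rw [if_neg h]
      push Not at h
      obtain ⟨E, hE, hEα⟩ := h
      rw [isCompatible_iff, not_forall] at hEα
      obtain ⟨v, hv⟩ := hEα
      exact Finset.prod_eq_zero (Finset.mem_univ v) (if_neg fun h' => hv (h' E hE))
  rw [fixCount_move]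
  push_cast
  rw [h1, h2, Finset.sum_mul_sum, Finset.sum_filter, Fintype.sum_prod_type]
  refine Finset.sum_congr rfl fun S _ => Finset.sum_congr rfl fun α _ => ?_
  by_cases hS : ∀ E ∈ w, IsContained E S
  · by_cases hα : ∀ E ∈ w, IsCompatible α E
    · rw [if_pos hS, if_pos hα, if_pos fun E hE => ⟨hS E hE, hα E hE⟩]
      rfl
    · rw [if_neg hα, mul_zero, if_neg fun h => hα fun E hE => (h E hE).2]
  · rw [if_neg hS, zero_mul, if_neg fun h => hS fun E hE => (h E hE).1]

theorem mult_nonneg (hforest : ∀ v : Bottom T d, IsRootedForest (Child v.1))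
    (S : Upset (LeafPoset T d)) (α : TreePartition T d) : 0 ≤ mult S α :=
  mul_nonneg (Finset.prod_nonneg fun v _ => derangementNumber_nonneg (hforest v) _)
    (Finset.prod_nonneg fun _ _ => Finset.prod_nonneg fun _ _ => by positivity)

/-! ### The trace formula for the transition matrix -/

variable {K : Type*} [Field K]

theorem transitionMatrix_eq_sum (x : Finset (Leaf T) → K) :
    transitionMatrix P x =
      ∑ E : {E // E ∈ admissible T}, x E.1 • mapMatrix K (move (P := P) E.1) := by
  ext π π'
  rw [transitionMatrix, Matrix.of_apply, Finset.sum_filter, Matrix.sum_apply,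
    ← Finset.sum_coe_sort]
  refine Finset.sum_congr rfl fun E _ => ?_
  simp [mapMatrix]

theorem eigval_eq_sum (x : Finset (Leaf T) → K) (S : Upset (LeafPoset T d))
    (α : TreePartition T d) :
    eigval x S α = ∑ E : {E // E ∈ admissible T} with
      IsContained E.1 S ∧ IsCompatible α E.1, x E.1 := by
  rw [eigval, Finset.sum_filter, Finset.sum_filter]
  exact (Finset.sum_coe_sort (admissible T) _).symm

theorem trace_transitionMatrix_pow (hd : 1 ≤ d)
    (hdepth : ∀ v : T, IsMax v → Order.height v = (d : ℕ∞))
    (hforest : ∀ v : Bottom T d, IsRootedForest (Child v.1))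
    (x : Finset (Leaf T) → K) (k : ℕ) :
    (transitionMatrix P x ^ k).trace =
      ∑ j : Upset (LeafPoset T d) × TreePartition T d,
        (mult j.1 j.2 : K) * eigval x j.1 j.2 ^ k := by
  -- Letters range over the subtype of admissible sets, since the fixed point formula requires at
  -- most one related child at each node of depth `d - 1`.
  have hfix : ∀ w : List {E // E ∈ admissible T},
      (fixCount (fun E : {E // E ∈ admissible T} => move (P := P) E.1) w : ℤ) =
        ∑ j : Upset (LeafPoset T d) × TreePartition T d with
          ∀ E ∈ w, IsContained E.1 j.1 ∧ IsCompatible j.2 E.1, mult j.1 j.2 := by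
    intro w
    have h1 : ∀ π, wordMap (fun E : {E // E ∈ admissible T} => move (P := P) E.1) w π =
        wordMap move (w.map Subtype.val) π := by
      intro π
      simp only [wordMap, List.foldl_map]
    have h2 := fixCount_move_eq_sum (P := P) hd hdepth hforest (w.map Subtype.val)
      (fun E hE => by
        obtain ⟨E', -, rfl⟩ := List.mem_map.1 hE
        exact E'.2)
    rw [fixCount_eq_card] at h2 ⊢
    simp only [h1, h2, List.forall_mem_map]
  rw [transitionMatrix_eq_sum]
  refine (trace_pow_sum_mapMatrix (fun E : {E // E ∈ admissible T} => move (P := P) E.1)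
    (fun E => x E.1) (fun j : Upset (LeafPoset T d) × TreePartition T d => mult j.1 j.2)
    (fun j E => IsContained E.1 j.1 ∧ IsCompatible j.2 E.1) (fun w => ?_) k).trans
    (Finset.sum_congr rfl fun j _ => ?_)
  · convert hfix w
  · rw [eigval_eq_sum]
    congr

end Tree

end TreeShuffle

end

theorem theorem3p1 (T : RootedTree) [Fintype T] (d : ℕ) (hd : 1 ≤ d)
    (hdepth : ∀ v : T, IsMax v → Order.height v = (d : ℕ∞))
    [P : ∀ v : TreeShuffle.Bottom T d, PartialOrder (TreeShuffle.Child v.1)]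
    (hforest : ∀ v : TreeShuffle.Bottom T d, TreeShuffle.IsRootedForest (TreeShuffle.Child v.1))
    {K : Type*} [Field K] [CharZero K] (x : Finset (TreeShuffle.Leaf T) → K) :
    (∀ (S : TreeShuffle.Upset (TreeShuffle.LeafPoset T d)) (α : TreeShuffle.TreePartition T d),
      0 ≤ TreeShuffle.mult S α) ∧
    (TreeShuffle.transitionMatrix P x).charpoly =
      ∏ S : TreeShuffle.Upset (TreeShuffle.LeafPoset T d),
        ∏ α : TreeShuffle.TreePartition T d,
          (Polynomial.X - Polynomial.C (TreeShuffle.eigval x S α)) ^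
            (TreeShuffle.mult S α).toNat ∧
    ∀ μ : K, Module.End.HasEigenvalue (Matrix.toLin' (TreeShuffle.transitionMatrix P x)) μ ↔
      ∃ (S : TreeShuffle.Upset (TreeShuffle.LeafPoset T d)) (α : TreeShuffle.TreePartition T d),
        0 < TreeShuffle.mult S α ∧ μ = TreeShuffle.eigval x S α := by
  have hchar := TreeShuffle.charpoly_eq_of_trace_pow _
    (fun j : TreeShuffle.Upset (TreeShuffle.LeafPoset T d) × TreeShuffle.TreePartition T d =>
      TreeShuffle.mult j.1 j.2)
    (fun j => TreeShuffle.mult_nonneg hforest j.1 j.2) _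
    (TreeShuffle.trace_transitionMatrix_pow hd hdepth hforest x)
  refine ⟨TreeShuffle.mult_nonneg hforest, hchar.trans (Fintype.prod_prod_type _), fun μ => ?_⟩
  rw [TreeShuffle.hasEigenvalue_iff_of_charpoly_eq hchar, Prod.exists]
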